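/- **Setting.** Let $\mathbf G$ be a weakly connected directed graph on $\{1,\dots,N\}$ without self-loops, $\mathbf V_i=\{j:(j,i)\in\mathbf E\}$, and let $p_i,q_i$ be the in- and out-degree of node $i$. Let $\rho:[0,\infty)\to\Gamma=[\rho^{\min},\rho^{\max}]$ be continuously differentiable. Consider the reference system and the agents $$\dot x=A(\rho(t))x+B_1\phi(x)+B_{20}w_0,\qquad \dot x_i=A(\rho(t))x_i+B_1\phi(x_i)+u_i+B_{2i}w_i\quad(i=1,\dots,N),$$ with states in $\mathbf R^n$, $x(0)=x_0$, $x_i(0)=x_{i0}$, where $A(\cdot)$ is continuous on $\Gamma$ and $\|\phi(z_1)-\phi(z_2)\|^2\le (z_1-z_2)'R(z_1-z_2)$ for all $z_1,z_2$, $R=R'\ge0$. With $y_i=C_{2i}x+D_{2i}w_i$ and $v_{ij}=H_{ij}x_j+G_{ij}w_{ij}$, $E_{2i}=D_{2i}D_{2i}'>0$, $F_{ij}=G_{ij}G_{ij}'>0$, the protocol is $$u_i=L_i(\rho(t))(y_i-C_{2i}x_i)+\sum_{j\in\mathbf V_i}K_{ij}(\rho(t))(v_{ij}-H_{ij}x_i).$$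 **Linear matrix inequalities.** Let $\gamma>0$, $\delta_i>0$, $Q_i=Q_i'>0$. For $\tau_i,\theta_i>0$, $X_i=X_i'>0$, $\alpha>0$, the coupled LMIs at $\rho$ are $$\begin{bmatrix}S_i(\rho)+\tau_iR+\theta_i\alpha^2I&T_i&X_i\\T_i'&-\Upsilon_i&0\\X_i&0&-\theta_iI\end{bmatrix}<0,\qquad i=1,\dots,N,\tag{1}$$ where, with $\hat A_i(\rho)=A(\rho)+\delta_iI+B_{2i}D_{2i}'E_{2i}^{-1}C_{2i}$, $$S_i(\rho)=X_i\hat A_i(\rho)+\hat A_i(\rho)'X_i+(p_i+q_i)I-\gamma^2C_{2i}'E_{2i}^{-1}C_{2i}-\gamma^2\sum_{j\in\mathbf V_i}H_{ij}'F_{ij}^{-1}H_{ij}+Q_i,$$ $$T_i=\big[X_iB_{20}\;\;X_iB_{2i}(I-D_{2i}'E_{2i}^{-1}D_{2i})\;\;X_iB_1\;\;\Xi_i\big],\quad \Xi_i=\big[\gamma^2H_{ij}'F_{ij}^{-1}H_{ij}-I\big]_{j\in\mathbf V_i},$$ $$\Upsilon_i=\mathrm{diag}[\gamma^2I,\gamma^2I,\tau_iI,Z_i],\quad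 Z_i=\mathrm{diag}\Big[\tfrac{2\delta_j}{q_j+1}X_j\Big]_{j\in\mathbf V_i}.$$ **Interpolated gains.** Let grid points $\rho^1<\dots<\rho^M$ with $\Gamma\subseteq[\rho^1,\rho^M]$, constants $\alpha_k>0$ and corner points $\rho^k<\underline\rho^{k+1}<\bar\rho^k<\rho^{k+1}$ be such that, for all $\rho\in\Gamma$, $(A(\rho)-A(\rho^k))'(A(\rho)-A(\rho^k))\le\alpha_k^2I$ if $\rho^k\le\rho<\bar\rho^k$, and $(A(\rho)-A(\rho^{k+1}))'(A(\rho)-A(\rho^{k+1}))\le\alpha_{k+1}^2I$ if $\underline\rho^{k+1}<\rho\le\rho^{k+1}$. For each $k$ let $(\tau_{i,\rho^k},\theta_{i,\rho^k},X_{i,\rho^k})$, $i=1,\dots,N$, be a feasible solution of (1) with $\rho=\rho^k$, $\alpha=\alpha_k$. For $\rho\in[\rho^k,\rho^{k+1}]$ put $X_{i,\rho}=X_{i,\rho^k}$ if $\rho\le\underline\rho^{k+1}$, $X_{i,\rho}=X_{i,\rho^{k+1}}$ if $\rho\ge\bar\rho^k$, and $X_{i,\rho}=\lambda X_{i,\rho^k}+(1-\lambda)X_{i,\rho^{k+1}}$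 with $\lambda=\frac{\bar\rho^k-\rho}{\bar\rho^k-\underline\rho^{k+1}}$ in between, and let $$K_{ij}(\rho)=\gamma^2X_{i,\rho}^{-1}H_{ij}'F_{ij}^{-1},\qquad L_i(\rho)=(\gamma^2X_{i,\rho}^{-1}C_{2i}'-B_{2i}D_{2i}')E_{2i}^{-1}.$$ **Theorem.** Suppose (with the convention $0^{-1}=+\infty$, and $\|\cdot\|$ the matrix norm induced by the Euclidean norm) $$\sup_{t\ge0}|\dot\rho(t)|\le\min_i\Big\{\lambda_{\min}(Q_i)\Big[\sup_k\frac{\|X_{i,\rho^{k+1}}-X_{i,\rho^k}\|}{\bar\rho^k-\underline\rho^{k+1}}\Big]^{-1}\Big\}.$$ Then, with $P=\mathrm{diag}\big[\tfrac1{\gamma^2N}X_{i,\rho(0)}\big]$ (and, if $\gamma\ge1$, also with $P=\mathrm{diag}\big[\tfrac1NX_{i,\rho(0)}\big]$), the protocol solves the weak robust synchronization problem. That is, $P=P'>0$, the functions $L_i,K_{ij}$ are continuous on $\Gamma$, and, with $e_i=x-x_i$: (i) there are $c,\omega>0$ such that, when all $w_0,w_i,w_{ij}$ vanish, $\|e_i(t)\|^2\le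 c\,e^{-\omega t}\sum_j\|e_j(0)\|^2$ for all $i$, all $t\ge0$ and all initial conditions; (ii) for all initial conditions and all $w_0,w_i,w_{ij}\in L_2[0,\infty)$ with $$\mathcal N:=\|[x_0-x_{i0}]_{i=1}^N\|_P^2+\|w_0\|_2^2+\frac1N\sum_{i=1}^N\Big(\|w_i\|_2^2+\sum_{j=1}^N\|w_{ij}\|_2^2\Big)\ne0,$$ one has $\displaystyle\frac1{\mathcal N}\int_0^\infty\frac1N\sum_{i=1}^N\sum_{j\in\mathbf V_i}\|e_j(t)-e_i(t)\|^2\,dt\le\gamma^2$; (iii) for all initial conditions and all $w_0,w_i,w_{ij}\in L_2[0,\infty)$, $\lim_{t\to\infty}\sum_{i=1}^N\|x(t)-x_i(t)\|^2=0$. -/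

import Mathlib

open scoped Matrix ENNReal Topology
open MeasureTheory

noncomputable section

namespace GainSync

/-- Euclidean space of dimension `d`. -/
abbrev E (d : ℕ) : Type := EuclideanSpace ℝ (Fin d)

/-- The product of a matrix and a Euclidean vector. -/
def mulE {a b : ℕ} (M : Matrix (Fin a) (Fin b) ℝ) (x : E b) : E a :=
  WithLp.toLp 2 (M *ᵥ x.ofLp)

/-- The quadratic form `z' P z`. -/
def quad {ι : Type} [Fintype ι] (P : Matrix ι ι ℝ) (z : ι → ℝ) : ℝ := z ⬝ᵥ (P *ᵥ z)

/-- The smallest eigenvalue of a symmetric matrix. -/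
def lambdaMin {d : ℕ} (P : Matrix (Fin d) (Fin d) ℝ) : ℝ := sInf (spectrum ℝ P)

/-- The matrix norm induced by the Euclidean vector norm. -/
def opNorm {d : ℕ} (P : Matrix (Fin d) (Fin d) ℝ) : ℝ :=
  ‖Matrix.toEuclideanCLM (𝕜 := ℝ) (n := Fin d) P‖

/-- `w` belongs to `L₂[0,∞)`. -/
def InL2 {d : ℕ} (w : ℝ → E d) : Prop := MemLp w 2 (volume.restrict (Set.Ici 0))

/-- The squared norm of `L₂[0,∞)`. -/
def sqL2 {d : ℕ} (w : ℝ → E d) : ℝ := ∫ t in Set.Ici (0 : ℝ), ‖w t‖ ^ 2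

/-- A Caratheodory solution on `[0,∞)` of `x' (t) = f (t, x (t))`. -/
def IsSolution {d : ℕ} (f : ℝ → E d → E d) (x : ℝ → E d) : Prop :=
  ContinuousOn x (Set.Ici 0) ∧ ∀ t, 0 ≤ t →
    IntervalIntegrable (fun s => f s (x s)) volume 0 t ∧ x t = x 0 + ∫ s in (0 : ℝ)..t, f s (x s)

/-- The data of a network of `N` parameter-varying agents with states in `ℝⁿ` and of the reference
system. An edge `graph.Adj j i` originates at `j` and ends at `i`. -/
structure Network (N n l r₀ : ℕ) where
  graph : Digraph (Fin N)
  /-- dimension of the disturbance of agent `i` -/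
  r : Fin N → ℕ
  /-- dimension of the measurement of agent `i` -/
  m : Fin N → ℕ
  /-- dimension of the disturbance of the channel from `j` to `i` -/
  rc : Fin N → Fin N → ℕ
  /-- dimension of the signal sent from `j` to `i` -/
  mc : Fin N → Fin N → ℕ
  A : ℝ → Matrix (Fin n) (Fin n) ℝ
  B₁ : Matrix (Fin n) (Fin l) ℝ
  φ : E n → E l
  B₂₀ : Matrix (Fin n) (Fin r₀) ℝ
  B₂ : ∀ i, Matrix (Fin n) (Fin (r i)) ℝ
  C₂ : ∀ i, Matrix (Fin (m i)) (Fin n) ℝ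
  D₂ : ∀ i, Matrix (Fin (m i)) (Fin (r i)) ℝ
  H : ∀ i j, Matrix (Fin (mc i j)) (Fin n) ℝ
  G : ∀ i j, Matrix (Fin (mc i j)) (Fin (rc i j)) ℝ

namespace Network

variable {N n l r₀ : ℕ} (S : Network N n l r₀)

open Classical in
/-- The neighbourhood of node `i`: the nodes that supply information to `i`. -/
def nbr (i : Fin N) : Finset (Fin N) := Finset.univ.filter fun j => S.graph.Adj j i

/-- The in-degree. -/
def p (i : Fin N) : ℕ := (S.nbr i).card

open Classical in
/-- The out-degree. -/
def q (i : Fin N) : ℕ := (Finset.univ.filter fun j => S.graph.Adj i j).card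

/-- `E_{2i} = D_{2i} D_{2i}'`. -/
def E₂ (i : Fin N) : Matrix (Fin (S.m i)) (Fin (S.m i)) ℝ := S.D₂ i * (S.D₂ i)ᵀ

/-- `F_{ij} = G_{ij} G_{ij}'`. -/
def F (i j : Fin N) : Matrix (Fin (S.mc i j)) (Fin (S.mc i j)) ℝ := S.G i j * (S.G i j)ᵀ

/-- The standing assumptions: the graph has no self-loops and is weakly connected, `A` is continuous
on `Γ`, `φ` is globally Lipschitz with weight `R = R' ≥ 0`, and `E_{2i}`, `F_{ij}` are positive
definite. -/
structure Standing (R : Matrix (Fin n) (Fin n) ℝ) (Γ : Set ℝ) : Prop where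
  no_loops : ∀ i, ¬ S.graph.Adj i i
  weakly_connected : S.graph.toSimpleGraphInclusive.Connected
  A_cont : ContinuousOn S.A Γ
  R_psd : R.PosSemidef
  lipschitz : ∀ x₁ x₂ : E n, ‖S.φ x₁ - S.φ x₂‖ ^ 2 ≤ quad R (x₁ - x₂).ofLp
  E_pos : ∀ i, (S.E₂ i).PosDef
  F_pos : ∀ i, ∀ j ∈ S.nbr i, (S.F i j).PosDef

/-! The disturbances, the closed loop and its trajectories. -/

/-- The disturbances `w₀`, `w_i`, `w_{ij}`. -/
structure Disturbance where
  w₀ : ℝ → E r₀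
  w : ∀ i, ℝ → E (S.r i)
  wc : ∀ i j, ℝ → E (S.rc i j)

/-- All disturbances vanish. -/
def noDisturbance : S.Disturbance := ⟨fun _ => 0, fun _ _ => 0, fun _ _ _ => 0⟩

/-- All disturbances are in `L₂[0,∞)`. -/
def Disturbance.AllL2 {S : Network N n l r₀} (d : S.Disturbance) : Prop :=
  InL2 d.w₀ ∧ (∀ i, InL2 (d.w i)) ∧ ∀ i j, InL2 (d.wc i j)

/-- Observer gain schedules `L_i(ρ)`. -/
abbrev ObsGain : Type := ∀ i, ℝ → Matrix (Fin n) (Fin (S.m i)) ℝ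

/-- Interconnection gain schedules `K_{ij}(ρ)`. -/
abbrev ConGain : Type := ∀ i j, ℝ → Matrix (Fin n) (Fin (S.mc i j)) ℝ

/-- The measurement `y_i = C_{2i} x + D_{2i} w_i`. -/
def y (d : S.Disturbance) (x : ℝ → E n) (i : Fin N) (t : ℝ) : E (S.m i) :=
  mulE (S.C₂ i) (x t) + mulE (S.D₂ i) (d.w i t)

/-- The signal `v_{ij} = H_{ij} x_j + G_{ij} w_{ij}`. -/
def v (d : S.Disturbance) (xs : Fin N → ℝ → E n) (i j : Fin N) (t : ℝ) : E (S.mc i j) :=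
  mulE (S.H i j) (xs j t) + mulE (S.G i j) (d.wc i j t)

/-- The protocol `u_i` under the parameter signal `ρ`. -/
def u (ρ : ℝ → ℝ) (L : S.ObsGain) (K : S.ConGain) (d : S.Disturbance) (x : ℝ → E n)
    (xs : Fin N → ℝ → E n) (i : Fin N) (t : ℝ) : E n :=
  mulE (L i (ρ t)) (S.y d x i t - mulE (S.C₂ i) (xs i t)) +
    ∑ j ∈ S.nbr i, mulE (K i j (ρ t)) (S.v d xs i j t - mulE (S.H i j) (xs i t))

/-- `x` is a trajectory of the reference system and `xs i` are the trajectories of the agents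
interconnected by the protocol. -/
def IsTrajectory (ρ : ℝ → ℝ) (L : S.ObsGain) (K : S.ConGain) (d : S.Disturbance) (x : ℝ → E n)
    (xs : Fin N → ℝ → E n) : Prop :=
  IsSolution (fun t z => mulE (S.A (ρ t)) z + mulE S.B₁ (S.φ z) + mulE S.B₂₀ (d.w₀ t)) x ∧
  ∀ i, IsSolution (fun t z => mulE (S.A (ρ t)) z + mulE S.B₁ (S.φ z) + S.u ρ L K d x xs i t +
    mulE (S.B₂ i) (d.w i t)) (xs i)

/-- The disagreement function. -/
def disagreement (e : Fin N → E n) : ℝ :=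
  (1 / (N : ℝ)) * ∑ i, ∑ j ∈ S.nbr i, ‖e j - e i‖ ^ 2

/-- The squared norm of the initial data and the disturbances; the errors `x₀ - x_{i0}` are
stacked and weighted with `P`. -/
def dataSq (P : Matrix (Fin n × Fin N) (Fin n × Fin N) ℝ) (x₀ : E n) (xs₀ : Fin N → E n)
    (d : S.Disturbance) : ℝ :=
  quad P (fun k => (x₀ - xs₀ k.2) k.1) + sqL2 d.w₀ +
    (1 / (N : ℝ)) * ∑ i, (sqL2 (d.w i) + ∑ j, sqL2 (d.wc i j))

/-- The gain schedules `L`, `K` solve the weak robust synchronization problem on the parameter set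
`Γ`, for the parameter signal `ρ`, with disagreement level `γ` and weight `P`. -/
structure WeakSync (Γ : Set ℝ) (ρ : ℝ → ℝ) (γ : ℝ) (L : S.ObsGain) (K : S.ConGain)
    (P : Matrix (Fin n × Fin N) (Fin n × Fin N) ℝ) : Prop where
  L_cont : ∀ i, ContinuousOn (L i) Γ
  K_cont : ∀ i, ∀ j ∈ S.nbr i, ContinuousOn (K i j) Γ
  P_pos : P.PosDef
  /-- Exponential stability of the unperturbed error dynamics, with constants that do not depend on
  the trajectory. -/
  exp_stable : ∃ c > 0, ∃ ω > 0, ∀ (x : ℝ → E n) (xs : Fin N → ℝ → E n),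
    S.IsTrajectory ρ L K S.noDisturbance x xs → ∀ i, ∀ t, 0 ≤ t →
      ‖x t - xs i t‖ ^ 2 ≤ c * Real.exp (-ω * t) * ∑ j, ‖x 0 - xs j 0‖ ^ 2
  /-- The guaranteed disagreement level. -/
  disagr : ∀ (d : S.Disturbance) (x : ℝ → E n) (xs : Fin N → ℝ → E n),
    d.AllL2 → S.IsTrajectory ρ L K d x xs → S.dataSq P (x 0) (fun i => xs i 0) d ≠ 0 →
      IntegrableOn (fun t => S.disagreement fun i => x t - xs i t) (Set.Ici 0) ∧
      (∫ t in Set.Ici (0 : ℝ), S.disagreement fun i => x t - xs i t) /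
        S.dataSq P (x 0) (fun i => xs i 0) d ≤ γ ^ 2
  /-- Asymptotic synchronization. -/
  converge : ∀ (d : S.Disturbance) (x : ℝ → E n) (xs : Fin N → ℝ → E n),
    d.AllL2 → S.IsTrajectory ρ L K d x xs →
      Filter.Tendsto (fun t => ∑ i, ‖x t - xs i t‖ ^ 2) Filter.atTop (𝓝 0)

/-! The linear matrix inequalities. -/

section LMI

variable (γ : ℝ) (δ : Fin N → ℝ) (Q : Fin N → Matrix (Fin n) (Fin n) ℝ)
  (X : Fin N → Matrix (Fin n) (Fin n) ℝ) (ρ : ℝ) (i : Fin N)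

/-- `A(ρ) + δ_i I + B_{2i} D_{2i}' E_{2i}⁻¹ C_{2i}`. -/
def shiftedA : Matrix (Fin n) (Fin n) ℝ :=
  S.A ρ + δ i • 1 + S.B₂ i * (S.D₂ i)ᵀ * (S.E₂ i)⁻¹ * S.C₂ i

/-- The matrix `S_i(ρ)`. -/
def lmiS : Matrix (Fin n) (Fin n) ℝ :=
  X i * S.shiftedA δ ρ i + (S.shiftedA δ ρ i)ᵀ * X i + ((S.p i : ℝ) + (S.q i : ℝ)) • 1
    - γ ^ 2 • ((S.C₂ i)ᵀ * (S.E₂ i)⁻¹ * S.C₂ i)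
    - γ ^ 2 • ∑ j ∈ S.nbr i, (S.H i j)ᵀ * (S.F i j)⁻¹ * S.H i j
    + Q i

/-- The index set of the blocks of `T_i` : `w₀`, `w_i`, the Lipschitz term, the neighbours. -/
abbrev MidIdx : Type := Fin r₀ ⊕ (Fin (S.r i) ⊕ (Fin l ⊕ (Fin n × {j // j ∈ S.nbr i})))

/-- The matrix `Ξ_i`, with one block for each neighbour. -/
def lmiXi : Matrix (Fin n) (Fin n × {j // j ∈ S.nbr i}) ℝ :=
  Matrix.of fun a k =>
    (γ ^ 2 • ((S.H i k.2)ᵀ * (S.F i k.2)⁻¹ * S.H i k.2) - 1 : Matrix (Fin n) (Fin n) ℝ) a k.1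

/-- The matrix `T_i`. -/
def lmiT : Matrix (Fin n) (S.MidIdx i) ℝ :=
  Matrix.fromCols (X i * S.B₂₀)
    (Matrix.fromCols (X i * S.B₂ i * (1 - (S.D₂ i)ᵀ * (S.E₂ i)⁻¹ * S.D₂ i))
      (Matrix.fromCols (X i * S.B₁) (S.lmiXi γ i)))

/-- The matrix `Z_i`. -/
def lmiZ : Matrix (Fin n × {j // j ∈ S.nbr i}) (Fin n × {j // j ∈ S.nbr i}) ℝ :=
  Matrix.blockDiagonal fun j : {j // j ∈ S.nbr i} => (2 * δ j / ((S.q j : ℝ) + 1)) • X j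

/-- The matrix `Υ_i`. -/
def lmiUpsilon (τ : Fin N → ℝ) : Matrix (S.MidIdx i) (S.MidIdx i) ℝ :=
  Matrix.fromBlocks (γ ^ 2 • 1) 0 0
    (Matrix.fromBlocks (γ ^ 2 • 1) 0 0 (Matrix.fromBlocks (τ i • 1) 0 0 (S.lmiZ δ X i)))

/-- The left-hand side of the coupled linear matrix inequality of agent `i`. -/
def lmi (α : ℝ) (R : Matrix (Fin n) (Fin n) ℝ) (τ θ : Fin N → ℝ) :
    Matrix ((Fin n ⊕ S.MidIdx i) ⊕ Fin n) ((Fin n ⊕ S.MidIdx i) ⊕ Fin n) ℝ :=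
  Matrix.fromBlocks
    (Matrix.fromBlocks (S.lmiS γ δ Q X ρ i + τ i • R + (θ i * α ^ 2) • 1) (S.lmiT γ X i)
      (S.lmiT γ X i)ᵀ (-S.lmiUpsilon γ δ X i τ))
    (Matrix.fromRows (X i)ᵀ 0) (Matrix.fromCols (X i) 0) (-(θ i • 1))

/-- `(τ_i, θ_i, X_i)`, `i = 1, …, N`, is a feasible collection for the coupled linear matrix
inequalities at `ρ`. -/
def Feasible (α : ℝ) (R : Matrix (Fin n) (Fin n) ℝ) (τ θ : Fin N → ℝ) : Prop :=
  ∀ i, 0 < τ i ∧ 0 < θ i ∧ (X i).PosDef ∧ (-S.lmi γ δ Q X ρ i α R τ θ).PosDef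

end LMI

/-- The observer gain schedule built from a matrix schedule `Y i ρ`. -/
def obsGain (γ : ℝ) (Y : Fin N → ℝ → Matrix (Fin n) (Fin n) ℝ) : S.ObsGain := fun i ρ =>
  (γ ^ 2 • ((Y i ρ)⁻¹ * (S.C₂ i)ᵀ) - S.B₂ i * (S.D₂ i)ᵀ) * (S.E₂ i)⁻¹

/-- The interconnection gain schedule built from a matrix schedule `Y i ρ`. -/
def conGain (γ : ℝ) (Y : Fin N → ℝ → Matrix (Fin n) (Fin n) ℝ) : S.ConGain := fun i j ρ =>
  γ ^ 2 • ((Y i ρ)⁻¹ * (S.H i j)ᵀ * (S.F i j)⁻¹)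

end Network

/-! The grid and the interpolation. -/

/-- Grid points `node 0 < … < node M`, and in each of the `M` grid intervals two corner points
`lo k < hi k` strictly inside. -/
structure Grid (M : ℕ) where
  node : Fin (M + 1) → ℝ
  lo : Fin M → ℝ
  hi : Fin M → ℝ
  node_lt_lo : ∀ k, node k.castSucc < lo k
  lo_lt_hi : ∀ k, lo k < hi k
  hi_lt_node : ∀ k, hi k < node k.succ

namespace Grid

variable {M n : ℕ} (g : Grid M) (X : Fin (M + 1) → Matrix (Fin n) (Fin n) ℝ)

/-- The interpolation on the `k`-th grid interval: constant, affine, constant. -/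
def piece (k : Fin M) (ρ : ℝ) : Matrix (Fin n) (Fin n) ℝ :=
  if ρ ≤ g.lo k then X k.castSucc
  else if ρ ≤ g.hi k then
    ((g.hi k - ρ) / (g.hi k - g.lo k)) • X k.castSucc +
      (1 - (g.hi k - ρ) / (g.hi k - g.lo k)) • X k.succ
  else X k.succ

open Classical in
/-- The interpolated matrix at `ρ`: choose a grid interval that contains `ρ`. By `interp_eq` the
choice does not matter. (When there is no grid interval, the value at the first node is taken.) -/
def interp (ρ : ℝ) : Matrix (Fin n) (Fin n) ℝ :=
  if h : ∃ k : Fin M, ρ ∈ Set.Icc (g.node k.castSucc) (g.node k.succ) then g.piece X h.choose ρ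
  else X 0

theorem strictMono_node : StrictMono g.node :=
  Fin.strictMono_iff_lt_succ.2 fun k =>
    (g.node_lt_lo k).trans ((g.lo_lt_hi k).trans (g.hi_lt_node k))

theorem piece_eq_of_lt {j k : Fin M} {ρ : ℝ} (hjk : j < k)
    (hj : ρ ∈ Set.Icc (g.node j.castSucc) (g.node j.succ))
    (hk : ρ ∈ Set.Icc (g.node k.castSucc) (g.node k.succ)) : g.piece X j ρ = g.piece X k ρ := by
  have h1 : j.succ ≤ k.castSucc := by
    rw [Fin.le_def]; simp only [Fin.val_succ, Fin.val_castSucc]; exact hjk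
  have h2 : g.node j.succ ≤ g.node k.castSucc := g.strictMono_node.monotone h1
  have h3 : ρ = g.node j.succ := le_antisymm hj.2 (h2.trans hk.1)
  have h4 : ρ = g.node k.castSucc := le_antisymm (hj.2.trans h2) hk.1
  have h5 : j.succ = k.castSucc := g.strictMono_node.injective (h3.symm.trans h4)
  have a1 := g.hi_lt_node j
  have a2 := g.lo_lt_hi j
  have a3 := g.node_lt_lo k
  have b1 : ¬ ρ ≤ g.lo j := by rw [h3]; linarith
  have b2 : ¬ ρ ≤ g.hi j := by rw [h3]; linarith
  have b3 : ρ ≤ g.lo k := by rw [h4]; exact a3.le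
  simp only [piece, if_neg b1, if_neg b2, if_pos b3, h5]

/-- The interpolation is given by the formula of any grid interval that contains `ρ`. -/
theorem interp_eq {k : Fin M} {ρ : ℝ}
    (hk : ρ ∈ Set.Icc (g.node k.castSucc) (g.node k.succ)) : g.interp X ρ = g.piece X k ρ := by
  have h : ∃ k : Fin M, ρ ∈ Set.Icc (g.node k.castSucc) (g.node k.succ) := ⟨k, hk⟩
  rw [interp, dif_pos h]
  rcases lt_trichotomy h.choose k with hlt | heq | hgt
  · exact g.piece_eq_of_lt X hlt h.choose_spec hk
  · rw [heq]
  · exact (g.piece_eq_of_lt X hgt hk h.choose_spec).symm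

end Grid

/-- The interpolated schedules `X_{i,ρ}`, as functions of `ρ`. -/
def schedule {N n M : ℕ} (g : Grid M) (X : Fin (M + 1) → Fin N → Matrix (Fin n) (Fin n) ℝ)
    (i : Fin N) : ℝ → Matrix (Fin n) (Fin n) ℝ := g.interp fun k => X k i

/-- `(A(ρ) - A(σ))' (A(ρ) - A(σ)) ≤ α² I`. -/
def CloseAt {n : ℕ} (A : ℝ → Matrix (Fin n) (Fin n) ℝ) (α σ ρ : ℝ) : Prop :=
  (α ^ 2 • (1 : Matrix (Fin n) (Fin n) ℝ) - (A ρ - A σ)ᵀ * (A ρ - A σ)).PosSemidef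

/-- The covering property of the grid and of the constants `α_k`. -/
def Covering {n M : ℕ} (A : ℝ → Matrix (Fin n) (Fin n) ℝ) (Γ : Set ℝ) (g : Grid M)
    (α : Fin (M + 1) → ℝ) : Prop :=
  ∀ k : Fin M, ∀ ρ ∈ Γ,
    (g.node k.castSucc ≤ ρ → ρ < g.hi k → CloseAt A (α k.castSucc) (g.node k.castSucc) ρ) ∧
    (g.lo k < ρ → ρ ≤ g.node k.succ → CloseAt A (α k.succ) (g.node k.succ) ρ)

/-- The bound on the rate of the parameter, in `[0,∞]` (so that the inverse of `0` is `∞`). -/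
def rateBound {N n M : ℕ} (g : Grid M) (Q : Fin N → Matrix (Fin n) (Fin n) ℝ)
    (X : Fin (M + 1) → Fin N → Matrix (Fin n) (Fin n) ℝ) : ℝ≥0∞ :=
  ⨅ i : Fin N, ENNReal.ofReal (lambdaMin (Q i)) *
    (⨆ k : Fin M, ENNReal.ofReal (opNorm (X k.succ i - X k.castSucc i) / (g.hi k - g.lo k)))⁻¹

end GainSync

end

/-! ### Quadratic forms, projections and norms. -/

namespace GainSync

section LinearAlgebra

variable {ι κ : Type} [Fintype ι] [Fintype κ]

/-! The storage function is `V(t) = ∑ e_i' X_{i,ρ(t)} e_i`, and everything follows from the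
inequality `V' + κ V + ∑_i ∑_{j ∈ V_i} ‖e_j - e_i‖² ≤ γ² (N ‖w₀‖² + ∑ (‖w_i‖² + ∑ ‖w_{ij}‖²))`,
valid for almost every time with any `κ ≤ min 2δ_i/(q_i+1)` (`Certificate.deriv_storage_le`).

At a node, the LMI is a quadratic inequality. Its last block pays for replacing `A(ρ^k)` by a nearby
`A(ρ)`, and the multiplier `τ_i` pays for the nonlinearity. Both multipliers are then eliminated
(`Feasible.dissipative`). What remains is affine in the family `X_j`, so two adjacent nodes that are
both close to `ρ` pass it on to the interpolated family (`Dissipative.convex`,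
`schedule_induction`). The gains are designed so that `X_i L_i` and `X_i K_{ij}` are free of
`X_i⁻¹`. Inserting them and completing squares in the measurement and channel noise gives the
estimate for one agent (`two_mul_dotProduct_errorField_le`). Summation over the agents turns the
coupling terms into the disagreement and leaves the decay `2δ_i/(q_i+1)` at node `i`.

The time dependence of `X_{i,ρ(t)}` adds a term to `V'`. The interpolation is only piecewise affine,
so no chain rule is used. Instead `t ↦ X_{i,ρ(t)}` is Lipschitz with constant `λ_min(Q_i)` by the
rate bound (`opNorm_schedule_comp_sub_le`), and its derivative, where it exists, is dominated by the
term `Q_i` of the LMI. Errors and weights are absolutely continuous, so the inequality can be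
integrated. The weight `exp(κ t)` gives exponential stability and convergence, and `κ = 0` gives the
disagreement bound. -/

theorem dotProduct_transpose_mulVec (M : Matrix ι κ ℝ) (x : κ → ℝ) (y : ι → ℝ) :
    x ⬝ᵥ (Mᵀ *ᵥ y) = (M *ᵥ x) ⬝ᵥ y := by
  rw [Matrix.dotProduct_mulVec, Matrix.vecMul_transpose]

theorem dotProduct_mulVec_comm {P : Matrix ι ι ℝ} (hP : Pᵀ = P) (x y : ι → ℝ) :
    x ⬝ᵥ (P *ᵥ y) = y ⬝ᵥ (P *ᵥ x) := by
  conv_lhs => rw [← hP, dotProduct_transpose_mulVec, dotProduct_comm]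

theorem quad_nonneg {P : Matrix ι ι ℝ} (hP : P.PosSemidef) (x : ι → ℝ) : 0 ≤ quad P x := by
  simpa [quad] using hP.dotProduct_mulVec_nonneg x

theorem quad_add {P : Matrix ι ι ℝ} (hP : Pᵀ = P) (x y : ι → ℝ) :
    quad P (x + y) = quad P x + 2 * (x ⬝ᵥ (P *ᵥ y)) + quad P y := by
  simp only [quad, Matrix.mulVec_add, add_dotProduct, dotProduct_add]
  rw [dotProduct_mulVec_comm hP y x]; ring

theorem norm_sq_eq_dotProduct {d : ℕ} (x : E d) : ‖x‖ ^ 2 = x.ofLp ⬝ᵥ x.ofLp := by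
  rw [EuclideanSpace.real_norm_sq_eq]
  simp [dotProduct, sq]

theorem dotProduct_self_nonneg' (x : ι → ℝ) : 0 ≤ x ⬝ᵥ x :=
  Finset.sum_nonneg fun i _ => mul_self_nonneg (x i)

/-- Young's inequality for the cross term `x' y`. -/
theorem two_mul_dotProduct_le {θ : ℝ} (hθ : 0 < θ) (x y : ι → ℝ) :
    2 * (x ⬝ᵥ y) ≤ θ⁻¹ * (x ⬝ᵥ x) + θ * (y ⬝ᵥ y) := by
  have h := dotProduct_self_nonneg' (x - θ • y)
  simp only [sub_dotProduct, dotProduct_sub, smul_dotProduct, dotProduct_smul, smul_eq_mul] at h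
  rw [dotProduct_comm y x] at h
  have h2 : 0 ≤ θ⁻¹ * (x ⬝ᵥ x - θ * (x ⬝ᵥ y) - (θ * (x ⬝ᵥ y) - θ * (θ * (y ⬝ᵥ y)))) :=
    mul_nonneg (inv_nonneg.2 hθ.le) (by linarith)
  have h3 : θ⁻¹ * (x ⬝ᵥ x - θ * (x ⬝ᵥ y) - (θ * (x ⬝ᵥ y) - θ * (θ * (y ⬝ᵥ y)))) =
      θ⁻¹ * (x ⬝ᵥ x) + θ * (y ⬝ᵥ y) - 2 * (x ⬝ᵥ y) := by field_simp; ring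
  linarith

variable [DecidableEq ι]

/-- The complementary projection of the row space of a matrix of full row rank. -/
theorem dotProduct_compl_proj {D : Matrix ι κ ℝ} [DecidableEq κ] (hD : (D * Dᵀ).PosDef)
    (w : κ → ℝ) :
    ((1 - Dᵀ * (D * Dᵀ)⁻¹ * D) *ᵥ w) ⬝ᵥ ((1 - Dᵀ * (D * Dᵀ)⁻¹ * D) *ᵥ w) =
      w ⬝ᵥ w - quad (D * Dᵀ)⁻¹ (D *ᵥ w) := by
  have hu : IsUnit (D * Dᵀ).det := (Matrix.isUnit_iff_isUnit_det _).1 hD.isUnit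
  have h1 : (D * Dᵀ) *ᵥ ((D * Dᵀ)⁻¹ *ᵥ (D *ᵥ w)) = D *ᵥ w := by
    rw [Matrix.mulVec_mulVec, Matrix.mul_nonsing_inv _ hu, Matrix.one_mulVec]
  rw [← Matrix.mulVec_mulVec] at h1
  simp only [Matrix.sub_mulVec, Matrix.one_mulVec, ← Matrix.mulVec_mulVec, sub_dotProduct,
    dotProduct_sub, dotProduct_transpose_mulVec, h1, quad]
  rw [dotProduct_comm (Dᵀ *ᵥ _) w, dotProduct_transpose_mulVec]
  ring

theorem proj_mul_proj {D : Matrix ι κ ℝ} [DecidableEq κ] (hD : (D * Dᵀ).PosDef) (w : κ → ℝ) :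
    (1 - Dᵀ * (D * Dᵀ)⁻¹ * D) *ᵥ ((1 - Dᵀ * (D * Dᵀ)⁻¹ * D) *ᵥ w) =
      (1 - Dᵀ * (D * Dᵀ)⁻¹ * D) *ᵥ w := by
  have hu : IsUnit (D * Dᵀ).det := (Matrix.isUnit_iff_isUnit_det _).1 hD.isUnit
  have h1 : (D * Dᵀ) *ᵥ ((D * Dᵀ)⁻¹ *ᵥ (D *ᵥ w)) = D *ᵥ w := by
    rw [Matrix.mulVec_mulVec, Matrix.mul_nonsing_inv _ hu, Matrix.one_mulVec]
  rw [← Matrix.mulVec_mulVec] at h1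
  simp only [Matrix.sub_mulVec, Matrix.one_mulVec, ← Matrix.mulVec_mulVec, Matrix.mulVec_sub, h1]
  abel

theorem quad_inv_mulVec_le {D : Matrix ι κ ℝ} (hD : (D * Dᵀ).PosDef) (w : κ → ℝ) :
    quad (D * Dᵀ)⁻¹ (D *ᵥ w) ≤ w ⬝ᵥ w := by
  classical
  have h := dotProduct_compl_proj hD w
  have h2 := dotProduct_self_nonneg' ((1 - Dᵀ * (D * Dᵀ)⁻¹ * D) *ᵥ w)
  linarith

/-- The quadratic form is at least the smallest eigenvalue times the squared norm. -/
theorem lambdaMin_mul_le_quad {d : ℕ} {P : Matrix (Fin d) (Fin d) ℝ} (hP : P.IsHermitian)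
    (x : Fin d → ℝ) : lambdaMin P * (x ⬝ᵥ x) ≤ quad P x := by
  have hps : (P - lambdaMin P • (1 : Matrix (Fin d) (Fin d) ℝ)).PosSemidef := by
    have hH : (P - lambdaMin P • (1 : Matrix (Fin d) (Fin d) ℝ)).IsHermitian := by
      refine hP.sub ?_
      simp [Matrix.IsHermitian]
    rw [hH.posSemidef_iff_eigenvalues_nonneg]
    intro i
    -- Adding `lambdaMin P` to an eigenvalue of the shifted matrix gives an eigenvalue of `P`, hence
    -- a number not below the infimum.
    have h1 := hH.eigenvalues_mem_spectrum_real i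
    have h2 : hH.eigenvalues i + lambdaMin P ∈ spectrum ℝ P := by
      rw [spectrum.mem_iff] at h1 ⊢
      convert h1 using 2
      rw [map_add, Algebra.algebraMap_eq_smul_one (lambdaMin P)]
      abel
    have h3 : lambdaMin P ≤ hH.eigenvalues i + lambdaMin P := by
      refine csInf_le ?_ h2
      rw [hP.spectrum_real_eq_range_eigenvalues]
      exact (Set.finite_range _).bddBelow
    simpa using h3
  have h := quad_nonneg hps x
  simp only [quad, Matrix.sub_mulVec, dotProduct_sub, Matrix.smul_mulVec, Matrix.one_mulVec,
    dotProduct_smul, smul_eq_mul] at h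
  simp only [quad]; linarith

theorem abs_quad_le_opNorm {d : ℕ} (P : Matrix (Fin d) (Fin d) ℝ) (x : E d) :
    |quad P x.ofLp| ≤ opNorm P * ‖x‖ ^ 2 := by
  have h : quad P x.ofLp = inner ℝ (Matrix.toEuclideanCLM (𝕜 := ℝ) (n := Fin d) P x) x := by
    simp [quad, EuclideanSpace.inner_eq_star_dotProduct, Matrix.ofLp_toEuclideanCLM]
  rw [h, sq, ← mul_assoc]
  refine (abs_real_inner_le_norm _ _).trans ?_
  gcongr
  exact ContinuousLinearMap.le_opNorm _ _

/-- An entry is a coordinate of the image of a unit vector. Lipschitz bounds in the operator norm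
thus pass to the entries, where scalar calculus applies. -/
theorem abs_entry_le_opNorm {d : ℕ} (P : Matrix (Fin d) (Fin d) ℝ) (a b : Fin d) :
    |P a b| ≤ opNorm P := by
  have h1 := (Matrix.toEuclideanCLM (𝕜 := ℝ) (n := Fin d) P).le_opNorm (EuclideanSpace.single b 1)
  have h2 : (Matrix.toEuclideanCLM (𝕜 := ℝ) (n := Fin d) P (EuclideanSpace.single b 1)) a =
      P a b := by
    simp [Matrix.ofLp_toEuclideanCLM]
  have h3 := PiLp.norm_apply_le
    (Matrix.toEuclideanCLM (𝕜 := ℝ) (n := Fin d) P (EuclideanSpace.single b 1)) a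
  rw [h2] at h3
  simp only [PiLp.norm_single, norm_one, mul_one] at h1
  exact h3.trans h1

end LinearAlgebra

end GainSync

/-! ### From the matrix inequalities to dissipation inequalities. -/

namespace GainSync

theorem quad_blockDiagonal {n : ℕ} {σ : Type} [Fintype σ] [DecidableEq σ]
    (P : σ → Matrix (Fin n) (Fin n) ℝ) (z : Fin n × σ → ℝ) :
    quad (Matrix.blockDiagonal P) z = ∑ j, quad (P j) (fun a => z (a, j)) := by
  simp only [quad, dotProduct, Matrix.mulVec, Fintype.sum_prod_type]
  rw [Finset.sum_comm]
  refine Finset.sum_congr rfl fun j _ => Finset.sum_congr rfl fun a _ => ?_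
  congr 1
  refine Finset.sum_congr rfl fun b _ => ?_
  rw [Finset.sum_eq_single j]
  · simp [Matrix.blockDiagonal_apply]
  · intro k _ hk
    simp [Matrix.blockDiagonal_apply, hk.symm]
  · simp

theorem quad_fromBlocks {ι κ : Type} [Fintype ι] [Fintype κ] (A : Matrix ι ι ℝ) (B : Matrix ι κ ℝ)
    (D : Matrix κ κ ℝ) (x : ι → ℝ) (y : κ → ℝ) :
    quad (Matrix.fromBlocks A B Bᵀ D) (Sum.elim x y) =
      quad A x + 2 * (x ⬝ᵥ (B *ᵥ y)) + quad D y := by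
  simp only [quad, Matrix.fromBlocks_mulVec, Sum.elim_comp_inl, Sum.elim_comp_inr,
    sumElim_dotProduct_sumElim, dotProduct_add, dotProduct_transpose_mulVec]
  rw [dotProduct_comm (B *ᵥ y) x]
  ring

theorem quad_fromBlocks_diagonal {ι κ : Type} [Fintype ι] [Fintype κ] (A : Matrix ι ι ℝ)
    (D : Matrix κ κ ℝ) (x : ι → ℝ) (y : κ → ℝ) :
    quad (Matrix.fromBlocks A 0 0 D) (Sum.elim x y) = quad A x + quad D y := by
  simpa using quad_fromBlocks A 0 D x y

theorem quad_smul {ι : Type} [Fintype ι] (c : ℝ) (P : Matrix ι ι ℝ) (x : ι → ℝ) :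
    quad (c • P) x = c * quad P x := by
  simp [quad, Matrix.smul_mulVec]

theorem quad_matrix_add {ι : Type} [Fintype ι] (P P' : Matrix ι ι ℝ) (x : ι → ℝ) :
    quad (P + P') x = quad P x + quad P' x := by
  simp [quad, Matrix.add_mulVec]

theorem quad_matrix_neg {ι : Type} [Fintype ι] (P : Matrix ι ι ℝ) (x : ι → ℝ) :
    quad (-P) x = -quad P x := by
  simp [quad, Matrix.neg_mulVec]

theorem quad_one {ι : Type} [Fintype ι] [DecidableEq ι] (x : ι → ℝ) :
    quad (1 : Matrix ι ι ℝ) x = x ⬝ᵥ x := by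
  simp [quad]

/-- The effect of the mismatch between `A(ρ)` and its value at a nearby grid point. -/
theorem CloseAt.two_mul_dotProduct_le {n : ℕ} {A : ℝ → Matrix (Fin n) (Fin n) ℝ} {α σ ρ θ : ℝ}
    (h : CloseAt A α σ ρ) (hθ : 0 < θ) (x e : Fin n → ℝ) :
    2 * (x ⬝ᵥ ((A ρ - A σ) *ᵥ e)) ≤ θ⁻¹ * (x ⬝ᵥ x) + θ * α ^ 2 * (e ⬝ᵥ e) := by
  have h1 := GainSync.two_mul_dotProduct_le hθ x ((A ρ - A σ) *ᵥ e)
  have h2 := quad_nonneg h e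
  simp only [quad, Matrix.sub_mulVec _ (_ * _), Matrix.smul_mulVec, Matrix.one_mulVec,
    dotProduct_sub, dotProduct_smul, smul_eq_mul, ← Matrix.mulVec_mulVec,
    dotProduct_transpose_mulVec] at h2
  have h3 := mul_le_mul_of_nonneg_left (sub_nonneg.1 h2) hθ.le
  linarith

namespace Network

variable {N n l r₀ : ℕ} (S : Network N n l r₀)

/-- The dissipation inequality of agent `i` that is encoded in the linear matrix inequality, at the
parameter value `ρ` and for the storage matrices `Y`. -/
def Dissipative (γ : ℝ) (δ : Fin N → ℝ) (Q : Fin N → Matrix (Fin n) (Fin n) ℝ)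
    (R : Matrix (Fin n) (Fin n) ℝ) (Y : Fin N → Matrix (Fin n) (Fin n) ℝ) (ρ : ℝ) (i : Fin N) :
    Prop :=
  ∀ (e : Fin n → ℝ) (w₀ : Fin r₀ → ℝ) (ω : Fin (S.r i) → ℝ) (f : Fin l → ℝ)
    (ξ : Fin N → Fin n → ℝ), f ⬝ᵥ f ≤ quad R e →
    2 * (e ⬝ᵥ (Y i *ᵥ (S.shiftedA δ ρ i *ᵥ e + S.B₂₀ *ᵥ w₀ +
        S.B₂ i *ᵥ ((1 - (S.D₂ i)ᵀ * (S.E₂ i)⁻¹ * S.D₂ i) *ᵥ ω) + S.B₁ *ᵥ f))) -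
      ∑ j ∈ S.nbr i, (2 * δ j / ((S.q j : ℝ) + 1)) * quad (Y j) (ξ j) +
      (((S.p i : ℝ) + (S.q i : ℝ)) * (e ⬝ᵥ e) - γ ^ 2 * quad (S.E₂ i)⁻¹ (S.C₂ i *ᵥ e) -
        γ ^ 2 * ∑ j ∈ S.nbr i, quad (S.F i j)⁻¹ (S.H i j *ᵥ e) + quad (Q i) e +
        2 * ∑ j ∈ S.nbr i,
          (γ ^ 2 * ((S.H i j *ᵥ e) ⬝ᵥ ((S.F i j)⁻¹ *ᵥ (S.H i j *ᵥ ξ j))) - e ⬝ᵥ ξ j) -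
        γ ^ 2 * (w₀ ⬝ᵥ w₀) - γ ^ 2 * (ω ⬝ᵥ ω)) ≤ 0

variable {S} {γ : ℝ} {δ : Fin N → ℝ} {Q : Fin N → Matrix (Fin n) (Fin n) ℝ}
  {R : Matrix (Fin n) (Fin n) ℝ}

/-- The inequality is affine in the whole family `Y`, and the multipliers `τ`, `θ` no longer occur
in it. Solutions found at two nodes with different multipliers can therefore be mixed, with one
weight common to all agents. -/
theorem Dissipative.convex {Y₁ Y₂ : Fin N → Matrix (Fin n) (Fin n) ℝ} {ρ : ℝ} {i : Fin N}
    (h₁ : S.Dissipative γ δ Q R Y₁ ρ i) (h₂ : S.Dissipative γ δ Q R Y₂ ρ i) {c : ℝ} (hc : 0 ≤ c)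
    (hc' : c ≤ 1) : S.Dissipative γ δ Q R (fun j => c • Y₁ j + (1 - c) • Y₂ j) ρ i := by
  intro e w₀ ω f ξ hf
  have a₁ := mul_le_mul_of_nonneg_left (h₁ e w₀ ω f ξ hf) hc
  have a₂ := mul_le_mul_of_nonneg_left (h₂ e w₀ ω f ξ hf) (sub_nonneg.2 hc')
  have hs : ∑ j ∈ S.nbr i, (2 * δ j / ((S.q j : ℝ) + 1)) *
      quad (c • Y₁ j + (1 - c) • Y₂ j) (ξ j) =
      c * ∑ j ∈ S.nbr i, (2 * δ j / ((S.q j : ℝ) + 1)) * quad (Y₁ j) (ξ j) +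
      (1 - c) * ∑ j ∈ S.nbr i, (2 * δ j / ((S.q j : ℝ) + 1)) * quad (Y₂ j) (ξ j) := by
    rw [Finset.mul_sum, Finset.mul_sum, ← Finset.sum_add_distrib]
    refine Finset.sum_congr rfl fun j _ => ?_
    simp only [quad, Matrix.add_mulVec, Matrix.smul_mulVec, dotProduct_add, dotProduct_smul,
      smul_eq_mul]
    ring
  rw [hs, Matrix.add_mulVec, Matrix.smul_mulVec, Matrix.smul_mulVec, dotProduct_add,
    dotProduct_smul, dotProduct_smul, smul_eq_mul, smul_eq_mul]
  linarith

theorem quad_lmiS {X : Fin N → Matrix (Fin n) (Fin n) ℝ} {i : Fin N} (hX : (X i)ᵀ = X i) (ρ : ℝ)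
    (e : Fin n → ℝ) :
    quad (S.lmiS γ δ Q X ρ i) e = 2 * (e ⬝ᵥ (X i *ᵥ (S.shiftedA δ ρ i *ᵥ e))) +
      ((S.p i : ℝ) + (S.q i : ℝ)) * (e ⬝ᵥ e) - γ ^ 2 * quad (S.E₂ i)⁻¹ (S.C₂ i *ᵥ e) -
        γ ^ 2 * ∑ j ∈ S.nbr i, quad (S.F i j)⁻¹ (S.H i j *ᵥ e) + quad (Q i) e := by
  have h1 : e ⬝ᵥ ((S.shiftedA δ ρ i)ᵀ *ᵥ (X i *ᵥ e)) = e ⬝ᵥ (X i *ᵥ (S.shiftedA δ ρ i *ᵥ e)) := by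
    rw [dotProduct_transpose_mulVec, dotProduct_mulVec_comm hX]
  simp only [quad, lmiS, Matrix.add_mulVec, Matrix.sub_mulVec, dotProduct_add, dotProduct_sub,
    Matrix.smul_mulVec, dotProduct_smul, smul_eq_mul, Matrix.sum_mulVec, dotProduct_sum,
    ← Matrix.mulVec_mulVec, dotProduct_transpose_mulVec, Matrix.one_mulVec]
  rw [dotProduct_transpose_mulVec] at h1
  rw [h1]
  ring

theorem lmiXi_mulVec (i : Fin N) (ξ : Fin N → Fin n → ℝ) :
    S.lmiXi γ i *ᵥ (fun k => ξ k.2 k.1) = ∑ j ∈ S.nbr i,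
      (γ ^ 2 • ((S.H i j)ᵀ * (S.F i j)⁻¹ * S.H i j) - 1 : Matrix (Fin n) (Fin n) ℝ) *ᵥ ξ j := by
  rw [← Finset.sum_coe_sort]
  ext a
  simp only [Matrix.mulVec, dotProduct, Fintype.sum_prod_type, lmiXi, Matrix.of_apply,
    Finset.sum_apply]
  exact Finset.sum_comm

/-- Evaluating the LMI at a suitable vector performs a Schur complement. The terms it leaves, `θ⁻¹
‖X e‖² + θ α² ‖e‖²`, bound the mismatch `2 e' X (A ρ - A σ) e`, while `τ (e' R e - ‖f‖²) ≥ 0` is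
dropped, as in the S-procedure. -/
theorem Feasible.dissipative {X : Fin N → Matrix (Fin n) (Fin n) ℝ} {σ α : ℝ} {τ θ : Fin N → ℝ}
    (h : S.Feasible γ δ Q X σ α R τ θ) {ρ : ℝ} (hρ : CloseAt S.A α σ ρ) (i : Fin N) :
    S.Dissipative γ δ Q R X ρ i := by
  intro e w₀ ω f ξ hf
  obtain ⟨hτ, hθ, hX, hl⟩ := h i
  have hXt : (X i)ᵀ = X i := by simpa using hX.isHermitian.eq
  set z : S.MidIdx i → ℝ := Sum.elim w₀ (Sum.elim ω (Sum.elim f fun k => ξ k.2 k.1)) with hz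
  -- The last component `θ⁻¹ X e` maximizes `2 v' X e - θ ‖v‖²` over `v`, with value `θ⁻¹ ‖X e‖²`.
  have h0 := quad_nonneg hl.posSemidef (Sum.elim (Sum.elim e z) ((θ i)⁻¹ • (X i *ᵥ e)))
  have hZ : quad (S.lmiZ δ X i) (fun k => ξ k.2 k.1) =
      ∑ j ∈ S.nbr i, (2 * δ j / ((S.q j : ℝ) + 1)) * quad (X j) (ξ j) := by
    rw [lmiZ, quad_blockDiagonal, ← Finset.sum_coe_sort (S.nbr i)
      fun j => (2 * δ j / ((S.q j : ℝ) + 1)) * quad (X j) (ξ j)]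
    exact Finset.sum_congr rfl fun j _ => quad_smul (2 * δ j / ((S.q j : ℝ) + 1)) (X j) (ξ j)
  have hT : e ⬝ᵥ (S.lmiT γ X i *ᵥ z) = e ⬝ᵥ (X i *ᵥ (S.B₂₀ *ᵥ w₀)) +
      e ⬝ᵥ (X i *ᵥ (S.B₂ i *ᵥ ((1 - (S.D₂ i)ᵀ * (S.E₂ i)⁻¹ * S.D₂ i) *ᵥ ω))) +
      e ⬝ᵥ (X i *ᵥ (S.B₁ *ᵥ f)) + ∑ j ∈ S.nbr i,
          (γ ^ 2 * ((S.H i j *ᵥ e) ⬝ᵥ ((S.F i j)⁻¹ *ᵥ (S.H i j *ᵥ ξ j))) - e ⬝ᵥ ξ j) := by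
    simp only [lmiT, hz, Matrix.fromCols_mulVec_sumElim, lmiXi_mulVec, dotProduct_add,
      dotProduct_sum, ← Matrix.mulVec_mulVec, ← add_assoc]
    congr 1
    refine Finset.sum_congr rfl fun j _ => ?_
    simp only [Matrix.sub_mulVec _ 1, Matrix.smul_mulVec, Matrix.one_mulVec, dotProduct_sub,
      dotProduct_smul, smul_eq_mul, ← Matrix.mulVec_mulVec, dotProduct_transpose_mulVec]
  have hU : quad (S.lmiUpsilon γ δ X i τ) z = γ ^ 2 * (w₀ ⬝ᵥ w₀) + γ ^ 2 * (ω ⬝ᵥ ω) +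
      τ i * (f ⬝ᵥ f) +
      ∑ j ∈ S.nbr i, (2 * δ j / ((S.q j : ℝ) + 1)) * quad (X j) (ξ j) := by
    simp only [lmiUpsilon, hz, quad_fromBlocks_diagonal, hZ, quad_smul, quad_one, ← add_assoc]
  have hb : (Matrix.fromCols (X i) 0 : Matrix (Fin n) (Fin n ⊕ S.MidIdx i) ℝ) =
      (Matrix.fromRows (X i)ᵀ 0)ᵀ := by
    rw [Matrix.transpose_fromRows, Matrix.transpose_transpose, Matrix.transpose_zero]
  have hx : (Sum.elim e z) ⬝ᵥ (Matrix.fromRows (X i)ᵀ (0 : Matrix (S.MidIdx i) (Fin n) ℝ) *ᵥ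
      ((θ i)⁻¹ • (X i *ᵥ e))) = (θ i)⁻¹ * ((X i *ᵥ e) ⬝ᵥ (X i *ᵥ e)) := by
    rw [Matrix.fromRows_mulVec, sumElim_dotProduct_sumElim, Matrix.zero_mulVec, dotProduct_zero,
      add_zero, dotProduct_transpose_mulVec, dotProduct_smul, smul_eq_mul]
  have hA : e ⬝ᵥ (X i *ᵥ (S.shiftedA δ ρ i *ᵥ e)) = e ⬝ᵥ (X i *ᵥ (S.shiftedA δ σ i *ᵥ e)) +
      (X i *ᵥ e) ⬝ᵥ ((S.A ρ - S.A σ) *ᵥ e) := by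
    have : S.shiftedA δ ρ i = S.shiftedA δ σ i + (S.A ρ - S.A σ) := by
      simp only [shiftedA]; abel
    rw [this, Matrix.add_mulVec, Matrix.mulVec_add, dotProduct_add, ← dotProduct_transpose_mulVec,
      hXt]
  have hc := hρ.two_mul_dotProduct_le hθ (X i *ᵥ e) e
  have hR := mul_le_mul_of_nonneg_left hf hτ.le
  rw [quad_matrix_neg, lmi, hb, quad_fromBlocks, quad_fromBlocks, hx, quad_matrix_neg,
    quad_matrix_neg, hT, hU, quad_smul, quad_one, quad_matrix_add, quad_matrix_add,
    quad_lmiS hXt, quad_smul, quad_smul, quad_one, dotProduct_smul, smul_dotProduct, smul_eq_mul,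
    smul_eq_mul, mul_inv_cancel_left₀ hθ.ne'] at h0
  simp only [Matrix.mulVec_add, dotProduct_add, hA]
  linarith

/-! ### The closed-loop error dynamics. -/

section ClosedLoop

variable {Y : Fin N → ℝ → Matrix (Fin n) (Fin n) ℝ} {ρ : ℝ} {i : Fin N}

theorem dotProduct_obsGain (hY : (Y i ρ).PosDef) (e : Fin n → ℝ) (v : Fin (S.m i) → ℝ) :
    e ⬝ᵥ (Y i ρ *ᵥ (S.obsGain γ Y i ρ *ᵥ v)) =
      γ ^ 2 * ((S.C₂ i *ᵥ e) ⬝ᵥ ((S.E₂ i)⁻¹ *ᵥ v)) -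
        e ⬝ᵥ (Y i ρ *ᵥ (S.B₂ i *ᵥ ((S.D₂ i)ᵀ *ᵥ ((S.E₂ i)⁻¹ *ᵥ v)))) := by
  have hu : IsUnit (Y i ρ).det := (Matrix.isUnit_iff_isUnit_det _).1 hY.isUnit
  simp only [obsGain, ← Matrix.mulVec_mulVec, Matrix.sub_mulVec, Matrix.smul_mulVec,
    Matrix.mulVec_sub, Matrix.mulVec_smul, dotProduct_sub, dotProduct_smul, smul_eq_mul]
  rw [Matrix.mulVec_mulVec _ (Y i ρ) (Y i ρ)⁻¹, Matrix.mul_nonsing_inv _ hu, Matrix.one_mulVec,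
    dotProduct_transpose_mulVec]

theorem dotProduct_conGain (hY : (Y i ρ).PosDef) (e : Fin n → ℝ) (j : Fin N)
    (v : Fin (S.mc i j) → ℝ) : e ⬝ᵥ (Y i ρ *ᵥ (S.conGain γ Y i j ρ *ᵥ v)) =
      γ ^ 2 * ((S.H i j *ᵥ e) ⬝ᵥ ((S.F i j)⁻¹ *ᵥ v)) := by
  have hu : IsUnit (Y i ρ).det := (Matrix.isUnit_iff_isUnit_det _).1 hY.isUnit
  simp only [conGain, ← Matrix.mulVec_mulVec, Matrix.smul_mulVec,
    Matrix.mulVec_smul, dotProduct_smul, smul_eq_mul]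
  rw [Matrix.mulVec_mulVec _ (Y i ρ) (Y i ρ)⁻¹, Matrix.mul_nonsing_inv _ hu, Matrix.one_mulVec,
    dotProduct_transpose_mulVec]

/-- Right-hand side of the error dynamics of agent `i`; `f` is the increment of the
nonlinearity. -/
noncomputable def errorField (γ : ℝ) (Y : Fin N → ℝ → Matrix (Fin n) (Fin n) ℝ) (ρ : ℝ) (i : Fin N)
    (e : Fin N → Fin n → ℝ) (f : Fin l → ℝ) (w₀ : Fin r₀ → ℝ) (w : Fin (S.r i) → ℝ)
    (wc : ∀ j, Fin (S.rc i j) → ℝ) : Fin n → ℝ :=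
  S.A ρ *ᵥ e i + S.B₁ *ᵥ f + S.B₂₀ *ᵥ w₀ -
    (S.obsGain γ Y i ρ *ᵥ (S.C₂ i *ᵥ e i + S.D₂ i *ᵥ w) +
      ∑ j ∈ S.nbr i, S.conGain γ Y i j ρ *ᵥ (S.H i j *ᵥ (e i - e j) + S.G i j *ᵥ wc j)) -
    S.B₂ i *ᵥ w

/-- The dissipation inequality is used with `ξ = e`. The injected terms contribute `-2γ²` times the
forms in `C₂ e` and `H e`, of which the LMI spends one half. The other half completes the squares of
`C₂ e + D₂ w` and `H e + G w_{ij}` in the inverse noise weights, at the cost of the noise energies.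
-/
theorem two_mul_dotProduct_errorField_le (hY : (Y i ρ).PosDef) (hE : (S.E₂ i).PosDef)
    (hF : ∀ j ∈ S.nbr i, (S.F i j).PosDef)
    (hdiss : S.Dissipative γ δ Q R (fun j => Y j ρ) ρ i) (e : Fin N → Fin n → ℝ) (f : Fin l → ℝ)
    (w₀ : Fin r₀ → ℝ) (w : Fin (S.r i) → ℝ) (wc : ∀ j, Fin (S.rc i j) → ℝ)
    (hf : f ⬝ᵥ f ≤ quad R (e i)) :
    2 * (e i ⬝ᵥ (Y i ρ *ᵥ errorField (S := S) γ Y ρ i e f w₀ w wc)) +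
        2 * δ i * quad (Y i ρ) (e i) + quad (Q i) (e i) +
        (((S.p i : ℝ) + (S.q i : ℝ)) * (e i ⬝ᵥ e i) - 2 * ∑ j ∈ S.nbr i, e i ⬝ᵥ e j) -
        ∑ j ∈ S.nbr i, (2 * δ j / ((S.q j : ℝ) + 1)) * quad (Y j ρ) (e j) ≤
      γ ^ 2 * (w₀ ⬝ᵥ w₀ + w ⬝ᵥ w + ∑ j ∈ S.nbr i, wc j ⬝ᵥ wc j) := by
  have hEt : ((S.E₂ i)⁻¹)ᵀ = (S.E₂ i)⁻¹ := by simpa using hE.inv.isHermitian.eq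
  -- After output injection the noise `w` drives the error through `-B₂ (1 - D₂' E₂⁻¹ D₂) w`. Its
  -- energy lacks exactly the part `w' D₂' E₂⁻¹ D₂ w`, which the square in `C₂ e + D₂ w` costs.
  have h1 := hdiss (e i) w₀ (-((1 - (S.D₂ i)ᵀ * (S.E₂ i)⁻¹ * S.D₂ i) *ᵥ w)) f e hf
  have hp1 : (1 - (S.D₂ i)ᵀ * (S.E₂ i)⁻¹ * S.D₂ i) *ᵥ
      ((1 - (S.D₂ i)ᵀ * (S.E₂ i)⁻¹ * S.D₂ i) *ᵥ w) =
      (1 - (S.D₂ i)ᵀ * (S.E₂ i)⁻¹ * S.D₂ i) *ᵥ w := proj_mul_proj hE w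
  have hp2 : ((1 - (S.D₂ i)ᵀ * (S.E₂ i)⁻¹ * S.D₂ i) *ᵥ w) ⬝ᵥ
      ((1 - (S.D₂ i)ᵀ * (S.E₂ i)⁻¹ * S.D₂ i) *ᵥ w) =
      w ⬝ᵥ w - quad (S.E₂ i)⁻¹ (S.D₂ i *ᵥ w) := dotProduct_compl_proj hE w
  have h2 := quad_nonneg hE.inv.posSemidef (S.C₂ i *ᵥ e i + S.D₂ i *ᵥ w)
  rw [quad_add hEt] at h2
  have h2' := mul_nonneg (sq_nonneg γ) h2
  have h3 : ∀ j ∈ S.nbr i, 0 ≤ γ ^ 2 * (quad (S.F i j)⁻¹ (S.H i j *ᵥ e i) +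
      2 * ((S.H i j *ᵥ e i) ⬝ᵥ ((S.F i j)⁻¹ *ᵥ (S.G i j *ᵥ wc j))) + wc j ⬝ᵥ wc j) := by
    intro j hj
    have hFt : ((S.F i j)⁻¹)ᵀ = (S.F i j)⁻¹ := by simpa using (hF j hj).inv.isHermitian.eq
    have a1 := quad_nonneg (hF j hj).inv.posSemidef (S.H i j *ᵥ e i + S.G i j *ᵥ wc j)
    rw [quad_add hFt] at a1
    have a2 : quad (S.F i j)⁻¹ (S.G i j *ᵥ wc j) ≤ _ := quad_inv_mulVec_le (hF j hj) (wc j)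
    exact mul_nonneg (sq_nonneg γ) (by linarith)
  have h4 := Finset.sum_nonneg h3
  simp only [← Finset.mul_sum, Finset.sum_add_distrib] at h4
  rw [Matrix.mulVec_neg, hp1, neg_dotProduct, dotProduct_neg, neg_neg, hp2] at h1
  simp only [shiftedA, Matrix.add_mulVec, Matrix.smul_mulVec, Matrix.one_mulVec,
    Matrix.mulVec_add, Matrix.mulVec_smul, Matrix.sub_mulVec, Matrix.mulVec_sub,
    Matrix.mulVec_neg, dotProduct_add, dotProduct_smul, dotProduct_neg, dotProduct_sub,
    smul_eq_mul, ← Matrix.mulVec_mulVec, Finset.sum_sub_distrib, ← Finset.mul_sum] at h1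
  simp only [errorField, Matrix.mulVec_add, Matrix.mulVec_sub, Matrix.mulVec_sum, dotProduct_add,
    dotProduct_sub, dotProduct_sum, dotProduct_obsGain hY, dotProduct_conGain hY,
    Finset.sum_add_distrib, Finset.sum_sub_distrib, ← Finset.mul_sum]
  simp only [quad] at h1 h2' h4 ⊢
  linarith

/-- Summation of the inequalities of the agents over the network. -/
theorem sum_two_mul_dotProduct_errorField_le (hE : ∀ i, (S.E₂ i).PosDef)
    (hF : ∀ i, ∀ j ∈ S.nbr i, (S.F i j).PosDef) (hY : ∀ i, (Y i ρ).PosDef)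
    (hdiss : ∀ i, S.Dissipative γ δ Q R (fun j => Y j ρ) ρ i) (e : Fin N → Fin n → ℝ)
    (f : Fin N → Fin l → ℝ) (w₀ : Fin r₀ → ℝ) (w : ∀ i, Fin (S.r i) → ℝ)
    (wc : ∀ i j, Fin (S.rc i j) → ℝ) (hf : ∀ i, f i ⬝ᵥ f i ≤ quad R (e i)) :
    ∑ i, (2 * (e i ⬝ᵥ (Y i ρ *ᵥ errorField (S := S) γ Y ρ i e (f i) w₀ (w i) (wc i))) +
        quad (Q i) (e i) + 2 * δ i / ((S.q i : ℝ) + 1) * quad (Y i ρ) (e i)) +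
        ∑ i, ∑ j ∈ S.nbr i, (e j - e i) ⬝ᵥ (e j - e i) ≤
      γ ^ 2 * (N * (w₀ ⬝ᵥ w₀) + ∑ i, (w i ⬝ᵥ w i + ∑ j, wc i j ⬝ᵥ wc i j)) := by
  classical
  -- Double counting of edges: node `j` is a neighbour of as many nodes as its out-degree.
  have hswap : ∀ a : Fin N → ℝ, ∑ i, ∑ j ∈ S.nbr i, a j = ∑ j, (S.q j : ℝ) * a j := by
    intro a
    simp only [nbr, q, Finset.sum_filter]
    rw [Finset.sum_comm]
    refine Finset.sum_congr rfl fun j _ => ?_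
    rw [← Finset.sum_filter, Finset.sum_const, nsmul_eq_mul]
  have h1 := Finset.sum_le_sum fun i (_ : i ∈ Finset.univ) =>
    two_mul_dotProduct_errorField_le (hY i) (hE i) (hF i) (hdiss i) e (f i) w₀ (w i) (wc i) (hf i)
  have h2 : ∑ i, γ ^ 2 * (w₀ ⬝ᵥ w₀ + w i ⬝ᵥ w i + ∑ j ∈ S.nbr i, wc i j ⬝ᵥ wc i j) ≤
      γ ^ 2 * (N * (w₀ ⬝ᵥ w₀) + ∑ i, (w i ⬝ᵥ w i + ∑ j, wc i j ⬝ᵥ wc i j)) := by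
    rw [← Finset.mul_sum]
    refine mul_le_mul_of_nonneg_left ?_ (sq_nonneg γ)
    simp only [Finset.sum_add_distrib, Finset.sum_const, Finset.card_univ, Fintype.card_fin,
      nsmul_eq_mul, add_assoc]
    gcongr with i
    · exact fun j _ _ => dotProduct_self_nonneg' _
    · exact Finset.subset_univ _
  have h3 : ∑ i, ∑ j ∈ S.nbr i, (e j - e i) ⬝ᵥ (e j - e i) =
      ∑ i, (((S.p i : ℝ) + (S.q i : ℝ)) * (e i ⬝ᵥ e i) - 2 * ∑ j ∈ S.nbr i, e i ⬝ᵥ e j) := by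
    have : ∀ i j, (e j - e i) ⬝ᵥ (e j - e i) = e j ⬝ᵥ e j + e i ⬝ᵥ e i - 2 * (e i ⬝ᵥ e j) := by
      intro i j
      simp only [sub_dotProduct, dotProduct_sub]
      rw [dotProduct_comm (e j) (e i)]; ring
    simp only [this, Finset.sum_sub_distrib, Finset.sum_add_distrib, hswap fun j => e j ⬝ᵥ e j,
      Finset.sum_const, nsmul_eq_mul, add_mul, ← Finset.mul_sum, p]
    ring
  have h4 := hswap fun j => 2 * δ j / ((S.q j : ℝ) + 1) * quad (Y j ρ) (e j)
  -- Of the `q_i + 1` equal shares of `2δ_i`, the coupling terms of the nodes fed by `i` use `q_i`.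
  -- One share survives as decay.
  have h5 : ∑ i, 2 * δ i * quad (Y i ρ) (e i) =
      ∑ i, 2 * δ i / ((S.q i : ℝ) + 1) * quad (Y i ρ) (e i) +
      ∑ i, (S.q i : ℝ) * (2 * δ i / ((S.q i : ℝ) + 1) * quad (Y i ρ) (e i)) := by
    rw [← Finset.sum_add_distrib]
    refine Finset.sum_congr rfl fun i _ => ?_
    have : (S.q i : ℝ) + 1 ≠ 0 := by positivity
    field_simp
    ring
  refine le_trans ?_ (h1.trans h2)
  rw [h3]
  simp only [Finset.sum_add_distrib, Finset.sum_sub_distrib] at h4 h5 ⊢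
  linarith

end ClosedLoop

end Network
end GainSync

/-! ### The interpolated schedules and their rate of variation. -/

namespace GainSync

/-- Lipschitz bounds on two adjacent intervals combine. -/
theorem norm_sub_le_of_adjacent {F : Type} [NormedAddCommGroup F] {f : ℝ → F} {a b c L : ℝ}
    (h₁ : ∀ x ∈ Set.Icc a b, ∀ y ∈ Set.Icc a b, ‖f x - f y‖ ≤ L * |x - y|)
    (h₂ : ∀ x ∈ Set.Icc b c, ∀ y ∈ Set.Icc b c, ‖f x - f y‖ ≤ L * |x - y|) (hab : a ≤ b)
    (hbc : b ≤ c) : ∀ x ∈ Set.Icc a c, ∀ y ∈ Set.Icc a c, ‖f x - f y‖ ≤ L * |x - y| := by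
  have key : ∀ x ∈ Set.Icc a b, ∀ y ∈ Set.Icc b c, ‖f x - f y‖ ≤ L * |x - y| := by
    intro x hx y hy
    have e1 := h₁ x hx b ⟨hab, le_rfl⟩
    have e2 := h₂ b ⟨le_rfl, hbc⟩ y hy
    have e3 : ‖f x - f y‖ ≤ ‖f x - f b‖ + ‖f b - f y‖ := norm_sub_le_norm_sub_add_norm_sub _ _ _
    rw [abs_of_nonpos (by linarith [hx.2])] at e1
    rw [abs_of_nonpos (by linarith [hy.1])] at e2
    rw [abs_of_nonpos (by linarith [hx.2, hy.1])]
    linarith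
  intro x hx y hy
  rcases le_total x b with hxb | hxb <;> rcases le_total y b with hyb | hyb
  · exact h₁ x ⟨hx.1, hxb⟩ y ⟨hy.1, hyb⟩
  · exact key x ⟨hx.1, hxb⟩ y ⟨hyb, hy.2⟩
  · rw [norm_sub_rev, abs_sub_comm]
    exact key y ⟨hy.1, hyb⟩ x ⟨hxb, hx.2⟩
  · exact h₂ x ⟨hxb, hx.2⟩ y ⟨hyb, hy.2⟩

theorem opNorm_nonneg {d : ℕ} (P : Matrix (Fin d) (Fin d) ℝ) : 0 ≤ opNorm P := norm_nonneg _

theorem opNorm_smul {d : ℕ} (c : ℝ) (P : Matrix (Fin d) (Fin d) ℝ) :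
    opNorm (c • P) = |c| * opNorm P := by
  rw [opNorm, map_smul, norm_smul, Real.norm_eq_abs, opNorm]

theorem opNorm_sub {d : ℕ} (P P' : Matrix (Fin d) (Fin d) ℝ) :
    opNorm (P - P') = ‖Matrix.toEuclideanCLM (𝕜 := ℝ) (n := Fin d) P -
      Matrix.toEuclideanCLM (𝕜 := ℝ) (n := Fin d) P'‖ := by
  rw [opNorm, map_sub]

namespace Grid

variable {M n : ℕ} (g : Grid M) (X : Fin (M + 1) → Matrix (Fin n) (Fin n) ℝ)

/-- The second alternative is the degenerate grid with a single node, where `interp` takes its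
default value. -/
theorem exists_mem_or_eq {ρ : ℝ} (h0 : g.node 0 ≤ ρ) (h1 : ρ ≤ g.node (Fin.last M)) :
    (∃ k : Fin M, ρ ∈ Set.Icc (g.node k.castSucc) (g.node k.succ)) ∨
      ρ = g.node 0 ∧ ∀ (d : ℕ) (X : Fin (M + 1) → Matrix (Fin d) (Fin d) ℝ),
        g.interp X ρ = X 0 := by
  by_cases h : ∃ k : Fin M, ρ ∈ Set.Icc (g.node k.castSucc) (g.node k.succ)
  · exact Or.inl h
  refine Or.inr ⟨?_, fun d X => dif_neg h⟩
  have key : ∀ j : Fin (M + 1), g.node j ≤ ρ ∧ (j = 0 ∨ g.node j < ρ) := by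
    intro j
    induction j using Fin.induction with
    | zero => exact ⟨h0, Or.inl rfl⟩
    | succ k ih =>
      have : g.node k.succ < ρ := not_le.1 fun h' => h ⟨k, ih.1, h'⟩
      exact ⟨this.le, Or.inr this⟩
  rcases (key (Fin.last M)).2 with h2 | h2
  · exact le_antisymm (h2 ▸ h1) h0
  · exact absurd h2 (not_lt.2 h1)

/-- The weight is an affine function clamped to `[0,1]`. Clamping does not increase distances, so
the Lipschitz constant is the slope of the middle part. -/
theorem piece_eq (k : Fin M) (ρ : ℝ) : g.piece X k ρ = X k.succ -
    max 0 (min 1 ((g.hi k - ρ) / (g.hi k - g.lo k))) • (X k.succ - X k.castSucc) := by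
  have h := g.lo_lt_hi k
  have h' : 0 < g.hi k - g.lo k := sub_pos.2 h
  unfold piece
  split_ifs with h1 h2
  · rw [min_eq_left ((one_le_div h').2 (by linarith)), max_eq_right zero_le_one, one_smul]
    abel
  · rw [min_eq_right ((div_le_one h').2 (by linarith)),
      max_eq_right (div_nonneg (by linarith) h'.le)]
    module
  · rw [max_eq_left, zero_smul, sub_zero]
    exact (min_le_right _ _).trans (div_nonpos_of_nonpos_of_nonneg (by linarith) h'.le)

theorem opNorm_piece_sub_le (k : Fin M) (ρ σ : ℝ) : opNorm (g.piece X k ρ - g.piece X k σ) ≤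
    opNorm (X k.succ - X k.castSucc) / (g.hi k - g.lo k) * |ρ - σ| := by
  have h' : 0 < g.hi k - g.lo k := sub_pos.2 (g.lo_lt_hi k)
  rw [piece_eq, piece_eq, sub_sub_sub_cancel_left, ← sub_smul, opNorm_smul]
  have h1 : |max 0 (min 1 ((g.hi k - σ) / (g.hi k - g.lo k))) -
      max 0 (min 1 ((g.hi k - ρ) / (g.hi k - g.lo k)))| ≤ |ρ - σ| / (g.hi k - g.lo k) := by
    refine (abs_max_sub_max_le_max _ _ _ _).trans ?_
    rw [sub_self, abs_zero, max_eq_right (abs_nonneg _)]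
    refine (abs_min_sub_min_le_max _ _ _ _).trans ?_
    rw [sub_self, abs_zero, max_eq_right (abs_nonneg _), ← sub_div, abs_div, abs_of_pos h',
      sub_sub_sub_cancel_left]
  calc _ ≤ |ρ - σ| / (g.hi k - g.lo k) * opNorm (X k.succ - X k.castSucc) :=
        mul_le_mul_of_nonneg_right h1 (opNorm_nonneg _)
    _ = _ := by ring

/-- The grid intervals are glued one at a time from the left. Adjacent pieces agree at the common
node, so a common bound on the slopes suffices. -/
theorem opNorm_interp_sub_le {L : ℝ}
    (hL : ∀ k : Fin M, opNorm (X k.succ - X k.castSucc) / (g.hi k - g.lo k) ≤ L) :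
    ∀ x ∈ Set.Icc (g.node 0) (g.node (Fin.last M)), ∀ y ∈ Set.Icc (g.node 0) (g.node (Fin.last M)),
      opNorm (g.interp X x - g.interp X y) ≤ L * |x - y| := by
  simp only [opNorm_sub]
  have key : ∀ j : Fin (M + 1), ∀ x ∈ Set.Icc (g.node 0) (g.node j),
      ∀ y ∈ Set.Icc (g.node 0) (g.node j),
      ‖Matrix.toEuclideanCLM (𝕜 := ℝ) (n := Fin n) (g.interp X x) -
        Matrix.toEuclideanCLM (𝕜 := ℝ) (n := Fin n) (g.interp X y)‖ ≤ L * |x - y| := by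
    intro j
    induction j using Fin.induction with
    | zero =>
      intro x hx y hy
      rw [Set.Icc_self] at hx hy
      rw [hx, hy]; simp
    | succ k ih =>
      refine norm_sub_le_of_adjacent
        (f := fun x => Matrix.toEuclideanCLM (𝕜 := ℝ) (n := Fin n) (g.interp X x)) ih ?_
        (g.strictMono_node.monotone (Fin.zero_le _))
        (g.strictMono_node.monotone (Fin.castSucc_lt_succ).le)
      intro x hx y hy
      simp only [← opNorm_sub]
      rw [g.interp_eq X hx, g.interp_eq X hy]
      exact (g.opNorm_piece_sub_le X k x y).trans
        (mul_le_mul_of_nonneg_right (hL k) (abs_nonneg _))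
  exact key _

end Grid

section Schedule

variable {N n l r₀ M : ℕ} {S : Network N n l r₀} {a b : ℝ} {R : Matrix (Fin n) (Fin n) ℝ} {γ : ℝ}
  {δ : Fin N → ℝ} {Q : Fin N → Matrix (Fin n) (Fin n) ℝ} {g : Grid M} {α : Fin (M + 1) → ℝ}
  {τ θ : Fin (M + 1) → Fin N → ℝ} {X : Fin (M + 1) → Fin N → Matrix (Fin n) (Fin n) ℝ}

/-- Every property of matrix families that is stable under convex combinations and holds at the
nodes that are close to `ρ` holds for the interpolated family. -/
theorem schedule_induction {A : ℝ → Matrix (Fin n) (Fin n) ℝ} {ρ : ℝ} (hρ : ρ ∈ Set.Icc a b)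
    (hga : g.node 0 ≤ a) (hgb : b ≤ g.node (Fin.last M)) (hcov : Covering A (Set.Icc a b) g α)
    {P : (Fin N → Matrix (Fin n) (Fin n) ℝ) → Prop}
    (hP : ∀ k, CloseAt A (α k) (g.node k) ρ → P (X k))
    (hconv : ∀ Y₁ Y₂ : Fin N → Matrix (Fin n) (Fin n) ℝ, P Y₁ → P Y₂ → ∀ c : ℝ, 0 ≤ c → c ≤ 1 →
      P fun j => c • Y₁ j + (1 - c) • Y₂ j) : P fun j => schedule g X j ρ := by
  rcases g.exists_mem_or_eq (hga.trans hρ.1) (hρ.2.trans hgb) with ⟨k, hk⟩ | ⟨h0, h1⟩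
  · have h' : 0 < g.hi k - g.lo k := sub_pos.2 (g.lo_lt_hi k)
    simp only [schedule, g.interp_eq _ hk, Grid.piece]
    have hlo : ρ < g.hi k → P (X k.castSucc) := fun h => hP _ ((hcov k ρ hρ).1 hk.1 h)
    have hhi : g.lo k < ρ → P (X k.succ) := fun h => hP _ ((hcov k ρ hρ).2 h hk.2)
    rcases le_or_gt ρ (g.lo k) with c1 | c1
    · simp only [if_pos c1]
      exact hlo (c1.trans_lt (g.lo_lt_hi k))
    rcases lt_or_ge ρ (g.hi k) with c2 | c2
    · simp only [if_neg (not_le.2 c1), if_pos c2.le]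
      exact hconv _ _ (hlo c2) (hhi c1) _ (div_nonneg (by linarith) h'.le)
        ((div_le_one h').2 (by linarith))
    -- At `ρ = hi k` the affine formula still applies, but closeness to the left node is no longer
    -- available. Its weight is zero there.
    · rcases c2.eq_or_lt with c3 | c3
      · subst c3
        simp only [if_neg (not_le.2 c1), le_refl, if_true, sub_self, zero_div, zero_smul,
          zero_add, sub_zero, one_smul]
        exact hhi c1
      · simp only [if_neg (not_le.2 c1), if_neg (not_le.2 c3)]
        exact hhi c1
  · simp only [schedule, h1]
    -- With a single node the covering property is empty, but `ρ` is the node itself and the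
    -- mismatch vanishes.
    refine hP 0 ?_
    rw [h0, CloseAt, sub_self, Matrix.mul_zero, sub_zero]
    exact Matrix.PosSemidef.one.smul (sq_nonneg _)

theorem dissipative_schedule (hX : ∀ k, S.Feasible γ δ Q (X k) (g.node k) (α k) R (τ k) (θ k))
    (hga : g.node 0 ≤ a) (hgb : b ≤ g.node (Fin.last M))
    (hcov : Covering S.A (Set.Icc a b) g α) {ρ : ℝ} (hρ : ρ ∈ Set.Icc a b) (i : Fin N) :
    S.Dissipative γ δ Q R (fun j => schedule g X j ρ) ρ i :=
  schedule_induction (P := fun Y => S.Dissipative γ δ Q R Y ρ i) hρ hga hgb hcov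
    (fun k hk => (hX k).dissipative hk i)
    fun _ _ h₁ h₂ _ hc hc' => h₁.convex h₂ hc hc'

theorem posDef_schedule (hX : ∀ k, S.Feasible γ δ Q (X k) (g.node k) (α k) R (τ k) (θ k))
    (hga : g.node 0 ≤ a) (hgb : b ≤ g.node (Fin.last M))
    (hcov : Covering S.A (Set.Icc a b) g α) {ρ : ℝ} (hρ : ρ ∈ Set.Icc a b) (i : Fin N) :
    (schedule g X i ρ).PosDef := by
  refine schedule_induction (P := fun Y => (Y i).PosDef) hρ hga hgb hcov
    (fun k _ => (hX k i).2.2.1) fun Y₁ Y₂ h₁ h₂ c hc hc' => ?_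
  rcases hc.eq_or_lt with rfl | hc
  · simpa using h₂
  · exact (h₁.smul hc).add_posSemidef (h₂.posSemidef.smul (sub_nonneg.2 hc'))

theorem exists_opNorm_schedule_sub_le (g : Grid M)
    (X : Fin (M + 1) → Fin N → Matrix (Fin n) (Fin n) ℝ) (i : Fin N) :
    ∃ L : ℝ, ∀ x ∈ Set.Icc (g.node 0) (g.node (Fin.last M)),
      ∀ y ∈ Set.Icc (g.node 0) (g.node (Fin.last M)),
        opNorm (schedule g X i x - schedule g X i y) ≤ L * |x - y| := by
  obtain ⟨L, hL⟩ := (Set.finite_range fun k : Fin M =>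
    opNorm (X k.succ i - X k.castSucc i) / (g.hi k - g.lo k)).bddAbove
  exact ⟨L, g.opNorm_interp_sub_le (fun k => X k i) fun k => hL ⟨k, rfl⟩⟩

theorem continuousOn_schedule (g : Grid M)
    (X : Fin (M + 1) → Fin N → Matrix (Fin n) (Fin n) ℝ) (i : Fin N) :
    ContinuousOn (schedule g X i) (Set.Icc (g.node 0) (g.node (Fin.last M))) := by
  obtain ⟨L, hL⟩ := exists_opNorm_schedule_sub_le g X i
  refine continuousOn_pi.2 fun p => continuousOn_pi.2 fun q => ?_
  refine (LipschitzOnWith.of_dist_le_mul (K := L.toNNReal) fun x hx y hy => ?_).continuousOn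
  rw [Real.dist_eq, Real.dist_eq]
  refine (abs_entry_le_opNorm (schedule g X i x - schedule g X i y) p q).trans
    ((hL x hx y hy).trans ?_)
  exact mul_le_mul_of_nonneg_right (Real.le_coe_toNNReal L) (abs_nonneg _)

theorem continuousOn_inv_schedule {s : Set ℝ}
    (hs : s ⊆ Set.Icc (g.node 0) (g.node (Fin.last M))) {i : Fin N}
    (hpos : ∀ ρ ∈ s, (schedule g X i ρ).PosDef) :
    ContinuousOn (fun ρ => (schedule g X i ρ)⁻¹) s := by
  have h := (continuousOn_schedule g X i).mono hs
  simp only [Matrix.inv_def, Ring.inverse_eq_inv']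
  refine ContinuousOn.smul (ContinuousOn.inv₀ ?_ fun ρ hρ => (hpos ρ hρ).det_pos.ne') ?_
  · exact continuous_id.matrix_det.comp_continuousOn h
  · exact continuous_id.matrix_adjugate.comp_continuousOn h

theorem continuousOn_obsGain_schedule {s : Set ℝ}
    (hs : s ⊆ Set.Icc (g.node 0) (g.node (Fin.last M))) {i : Fin N}
    (hpos : ∀ ρ ∈ s, (schedule g X i ρ).PosDef) :
    ContinuousOn (S.obsGain γ (schedule g X) i) s := by
  have h := continuousOn_inv_schedule hs hpos
  have hc : Continuous fun Z : Matrix (Fin n) (Fin n) ℝ =>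
      (γ ^ 2 • (Z * (S.C₂ i)ᵀ) - S.B₂ i * (S.D₂ i)ᵀ) * (S.E₂ i)⁻¹ := by fun_prop
  exact hc.comp_continuousOn h

theorem continuousOn_conGain_schedule {s : Set ℝ}
    (hs : s ⊆ Set.Icc (g.node 0) (g.node (Fin.last M))) {i : Fin N}
    (hpos : ∀ ρ ∈ s, (schedule g X i ρ).PosDef) (j : Fin N) :
    ContinuousOn (S.conGain γ (schedule g X) i j) s := by
  have h := continuousOn_inv_schedule hs hpos
  have hc : Continuous fun Z : Matrix (Fin n) (Fin n) ℝ =>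
      γ ^ 2 • (Z * (S.H i j)ᵀ * (S.F i j)⁻¹) := by fun_prop
  exact hc.comp_continuousOn h

theorem lambdaMin_nonneg {d : ℕ} {P : Matrix (Fin d) (Fin d) ℝ} (hP : P.PosDef) :
    0 ≤ lambdaMin P := by
  refine Real.sInf_nonneg fun x hx => ?_
  rw [hP.isHermitian.spectrum_real_eq_range_eigenvalues] at hx
  obtain ⟨k, rfl⟩ := hx
  exact (hP.eigenvalues_pos k).le

/-- Along the parameter signal the interpolated matrices vary no faster than the smallest
eigenvalue of `Q i` allows. -/
theorem opNorm_schedule_comp_sub_le {ρ : ℝ → ℝ} (hρ : DifferentiableOn ℝ ρ (Set.Ici 0))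
    (hρΓ : ∀ t, 0 ≤ t → ρ t ∈ Set.Icc (g.node 0) (g.node (Fin.last M)))
    (hQ : ∀ i, (Q i).PosDef)
    (hrate : (⨆ t ∈ Set.Ici (0 : ℝ), ‖derivWithin ρ (Set.Ici 0) t‖ₑ) ≤ rateBound g Q X) (i : Fin N)
    {s t : ℝ} (hs : 0 ≤ s) (ht : 0 ≤ t) :
    opNorm (schedule g X i (ρ t) - schedule g X i (ρ s)) ≤ lambdaMin (Q i) * |t - s| := by
  set c : ℝ≥0∞ := ⨆ k : Fin M,
    ENNReal.ofReal (opNorm (X k.succ i - X k.castSucc i) / (g.hi k - g.lo k)) with hc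
  have hctop : c ≠ ⊤ := by
    refine (iSup_lt_iff.2 ?_).ne
    obtain ⟨L, hL⟩ := (Set.finite_range fun k : Fin M =>
      opNorm (X k.succ i - X k.castSucc i) / (g.hi k - g.lo k)).bddAbove
    exact ⟨ENNReal.ofReal L, ENNReal.ofReal_lt_top, fun k =>
      ENNReal.ofReal_le_ofReal (hL ⟨k, rfl⟩)⟩
  have hL : ∀ k : Fin M, opNorm (X k.succ i - X k.castSucc i) / (g.hi k - g.lo k) ≤ c.toReal :=
    fun k => (ENNReal.ofReal_le_iff_le_toReal hctop).1
      (le_iSup (fun k : Fin M => ENNReal.ofReal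
        (opNorm (X k.succ i - X k.castSucc i) / (g.hi k - g.lo k))) k)
  -- The rate bound is used in the form `|ρ'| c ≤ λ_min(Q_i)`, which also covers `c = 0`, where `c⁻¹
  -- = ∞`.
  have hder : ∀ u ∈ Set.Ici (0 : ℝ), ‖derivWithin (fun u => c.toReal * ρ u) (Set.Ici 0) u‖ ≤
      lambdaMin (Q i) := by
    intro u hu
    have h1 : ‖derivWithin ρ (Set.Ici 0) u‖ₑ ≤ ENNReal.ofReal (lambdaMin (Q i)) * c⁻¹ :=
      (le_iSup₂ (f := fun t (_ : t ∈ Set.Ici (0 : ℝ)) => ‖derivWithin ρ (Set.Ici 0) t‖ₑ) u hu).trans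
        (hrate.trans (iInf_le _ i))
    have h2 : ‖derivWithin ρ (Set.Ici 0) u‖ₑ * c ≤ ENNReal.ofReal (lambdaMin (Q i)) := by
      refine (mul_le_mul_left h1 c).trans ?_
      rw [mul_assoc]
      exact mul_le_of_le_one_right zero_le (ENNReal.inv_mul_le_one c)
    rw [derivWithin_const_mul _ (hρ u hu), norm_mul, Real.norm_of_nonneg ENNReal.toReal_nonneg,
      mul_comm]
    rw [← ENNReal.ofReal_le_ofReal_iff (lambdaMin_nonneg (hQ i)),
      ENNReal.ofReal_mul (norm_nonneg _), ENNReal.ofReal_toReal hctop, ofReal_norm]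
    exact h2
  have h3 := (convex_Ici (0 : ℝ)).norm_image_sub_le_of_norm_derivWithin_le
    (fun u hu => ((hρ u hu).const_mul c.toReal)) hder (Set.mem_Ici.2 hs) (Set.mem_Ici.2 ht)
  rw [← mul_sub, norm_mul, Real.norm_of_nonneg ENNReal.toReal_nonneg, Real.norm_eq_abs,
    Real.norm_eq_abs] at h3
  exact (g.opNorm_interp_sub_le (fun k => X k i) hL _ (hρΓ t ht) _ (hρΓ s hs)).trans h3

end Schedule

end GainSync

/-! ### Absolute continuity and differentiation along trajectories. -/

namespace GainSync

section AbsolutelyContinuous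

variable {s t : ℝ}

theorem absolutelyContinuousOnInterval_congr {f g : ℝ → ℝ}
    (hf : AbsolutelyContinuousOnInterval f s t) (h : Set.EqOn f g (Set.uIcc s t)) :
    AbsolutelyContinuousOnInterval g s t := by
  rw [absolutelyContinuousOnInterval_iff] at hf ⊢
  intro ε hε
  obtain ⟨d, hd, H⟩ := hf ε hε
  refine ⟨d, hd, fun I hI hlt => ?_⟩
  refine lt_of_eq_of_lt (Finset.sum_congr rfl fun k hk => ?_) (H I hI hlt)
  rw [h (hI.1 k hk).1, h (hI.1 k hk).2]

theorem absolutelyContinuousOnInterval_sum {σ : Type} (u : Finset σ) {f : σ → ℝ → ℝ}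
    (h : ∀ k ∈ u, AbsolutelyContinuousOnInterval (f k) s t) :
    AbsolutelyContinuousOnInterval (fun x => ∑ k ∈ u, f k x) s t := by
  classical
  induction u using Finset.induction_on with
  | empty =>
    simpa using ((LipschitzWith.const (0 : ℝ)).lipschitzOnWith
      (s := Set.uIcc s t)).absolutelyContinuousOnInterval
  | insert a u ha ih =>
    simp only [Finset.sum_insert ha]
    exact (h a (Finset.mem_insert_self a u)).fun_add
      (ih fun k hk => h k (Finset.mem_insert_of_mem hk))

theorem absolutelyContinuousOnInterval_quad {ι : Type} [Fintype ι] {Y : ℝ → Matrix ι ι ℝ}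
    {e : ℝ → ι → ℝ} (hY : ∀ a b, AbsolutelyContinuousOnInterval (fun x => Y x a b) s t)
    (he : ∀ a, AbsolutelyContinuousOnInterval (fun x => e x a) s t) :
    AbsolutelyContinuousOnInterval (fun x => quad (Y x) (e x)) s t := by
  simp only [quad, dotProduct, Matrix.mulVec]
  exact absolutelyContinuousOnInterval_sum _ fun a _ => (he a).mul
    (absolutelyContinuousOnInterval_sum _ fun b _ => (hY a b).mul (he b))

theorem hasDerivAt_quad {ι : Type} [Fintype ι] {Y : ℝ → Matrix ι ι ℝ} {e : ℝ → ι → ℝ} {u : ℝ}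
    {Y' : Matrix ι ι ℝ} {e' : ι → ℝ} (hY : ∀ a b, HasDerivAt (fun x => Y x a b) (Y' a b) u)
    (he : ∀ a, HasDerivAt (fun x => e x a) (e' a) u) (hsymm : (Y u)ᵀ = Y u) :
    HasDerivAt (fun x => quad (Y x) (e x)) (2 * (e u ⬝ᵥ (Y u *ᵥ e')) + quad Y' (e u)) u := by
  have h : HasDerivAt (fun x => quad (Y x) (e x))
      (∑ a, (e' a * ∑ b, Y u a b * e u b + e u a * ∑ b, (Y' a b * e u b + Y u a b * e' b))) u := by
    simp only [quad, dotProduct, Matrix.mulVec]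
    exact HasDerivAt.fun_sum fun a _ => (he a).mul
      (HasDerivAt.fun_sum fun b _ => (hY a b).mul (he b))
  convert h using 1
  have h1 : 2 * (e u ⬝ᵥ (Y u *ᵥ e')) = e' ⬝ᵥ (Y u *ᵥ e u) + e u ⬝ᵥ (Y u *ᵥ e') := by
    rw [dotProduct_mulVec_comm hsymm e' (e u)]; ring
  rw [h1]
  simp only [quad, dotProduct, Matrix.mulVec, Finset.sum_add_distrib, mul_add]
  ring

/-- Comparison: a differential inequality that holds almost everywhere, with an exponential
weight. -/
theorem exp_mul_add_integral_le {V D G : ℝ → ℝ} {κ : ℝ} (hst : s ≤ t)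
    (hV : AbsolutelyContinuousOnInterval V s t) (hD : IntervalIntegrable D volume s t)
    (hG : IntervalIntegrable G volume s t)
    (h : ∀ᵐ u, u ∈ Set.Icc s t → deriv V u + κ * V u + D u ≤ G u) :
    Real.exp (κ * t) * V t + ∫ u in s..t, Real.exp (κ * u) * D u ≤
      Real.exp (κ * s) * V s + ∫ u in s..t, Real.exp (κ * u) * G u := by
  have hexp : AbsolutelyContinuousOnInterval (fun u => Real.exp (κ * u)) s t :=
    ContDiffOn.absolutelyContinuousOnInterval (by fun_prop)
  have hW := hexp.mul hV
  have hc : ContinuousOn (fun u => Real.exp (κ * u)) (Set.uIcc s t) := by fun_prop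
  have hiD := hD.continuousOn_mul hc
  have hiG := hG.continuousOn_mul hc
  have key : ∫ u in s..t, deriv ((fun u => Real.exp (κ * u)) * V) u ≤
      ∫ u in s..t, (Real.exp (κ * u) * G u - Real.exp (κ * u) * D u) := by
    refine intervalIntegral.integral_mono_ae_restrict hst hW.intervalIntegrable_deriv
      (hiG.sub hiD) ?_
    rw [Filter.EventuallyLE, ae_restrict_iff' measurableSet_Icc]
    filter_upwards [h, hV.ae_differentiableAt] with u hu hdu hmem
    have hdV := (hdu (by rwa [Set.uIcc_of_le hst])).hasDerivAt
    have hde : HasDerivAt (fun u => Real.exp (κ * u)) (Real.exp (κ * u) * κ) u := by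
      simpa using ((hasDerivAt_id u).const_mul κ).exp
    rw [(hde.mul hdV).deriv]
    have := mul_le_mul_of_nonneg_left (hu hmem) (Real.exp_pos (κ * u)).le
    linarith
  rw [hW.integral_deriv_eq_sub, intervalIntegral.integral_sub hiG hiD] at key
  simp only [Pi.mul_apply] at key
  linarith

end AbsolutelyContinuous

section Solutions

variable {d : ℕ}

theorem intervalIntegrable_ofLp_apply {f : ℝ → E d} {s t : ℝ} (h : IntervalIntegrable f volume s t)
    (a : Fin d) : IntervalIntegrable (fun u => f u a) volume s t :=
  ⟨(EuclideanSpace.proj (𝕜 := ℝ) a).integrable_comp h.1,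
    (EuclideanSpace.proj (𝕜 := ℝ) a).integrable_comp h.2⟩

theorem IsSolution.apply_sub_eq {f₁ f₂ : ℝ → E d → E d} {x₁ x₂ : ℝ → E d} (h₁ : IsSolution f₁ x₁)
    (h₂ : IsSolution f₂ x₂) {t : ℝ} (ht : 0 ≤ t) (a : Fin d) : (x₁ t - x₂ t) a =
      (x₁ 0 - x₂ 0) a + ∫ s in (0 : ℝ)..t, (f₁ s (x₁ s) - f₂ s (x₂ s)) a := by
  have hi := ((h₁.2 t ht).1.sub (h₂.2 t ht).1)
  have h3 : x₁ t - x₂ t = x₁ 0 - x₂ 0 + ∫ s in (0 : ℝ)..t, (f₁ s (x₁ s) - f₂ s (x₂ s)) := by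
    rw [intervalIntegral.integral_sub (h₁.2 t ht).1 (h₂.2 t ht).1, (h₁.2 t ht).2, (h₂.2 t ht).2]
    rw [add_sub_add_comm]
  have h4 := (EuclideanSpace.proj (𝕜 := ℝ) a).intervalIntegral_comp_comm hi
  rw [h3, PiLp.add_apply]
  congr 1
  exact h4.symm

theorem IsSolution.absolutelyContinuousOnInterval_sub {f₁ f₂ : ℝ → E d → E d} {x₁ x₂ : ℝ → E d}
    (h₁ : IsSolution f₁ x₁) (h₂ : IsSolution f₂ x₂) {s t : ℝ} (hs : 0 ≤ s) (hst : s ≤ t)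
    (a : Fin d) : AbsolutelyContinuousOnInterval (fun u => (x₁ u - x₂ u) a) s t := by
  have ht := hs.trans hst
  have hi := intervalIntegrable_ofLp_apply ((h₁.2 t ht).1.sub (h₂.2 t ht).1) a
  have hac := hi.absolutelyContinuousOnInterval_intervalIntegral (c := 0) Set.left_mem_uIcc
  have hc : AbsolutelyContinuousOnInterval (fun _ : ℝ => (x₁ 0 - x₂ 0) a) 0 t :=
    ((LipschitzWith.const _).lipschitzOnWith (s := Set.uIcc 0 t)).absolutelyContinuousOnInterval
  have hsub : Set.uIcc s t ⊆ Set.uIcc 0 t := by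
    rw [Set.uIcc_of_le hst, Set.uIcc_of_le ht]; exact Set.Icc_subset_Icc_left hs
  refine absolutelyContinuousOnInterval_congr ((hc.fun_add hac).mono hsub) fun u hu => ?_
  rw [Set.uIcc_of_le hst] at hu
  exact (h₁.apply_sub_eq h₂ (hs.trans hu.1) a).symm

theorem IsSolution.ae_hasDerivAt_sub {f₁ f₂ : ℝ → E d → E d} {x₁ x₂ : ℝ → E d}
    (h₁ : IsSolution f₁ x₁) (h₂ : IsSolution f₂ x₂) (t : ℝ) :
    ∀ᵐ u, u ∈ Set.Ioo 0 t → ∀ a : Fin d,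
      HasDerivAt (fun u => (x₁ u - x₂ u) a) ((f₁ u (x₁ u) - f₂ u (x₂ u)) a) u := by
  rcases lt_or_ge t 0 with ht | ht
  · exact Filter.Eventually.of_forall fun u hu => absurd (hu.1.trans hu.2) (not_lt.2 ht.le)
  have h : ∀ᵐ u, ∀ a : Fin d, u ∈ Set.uIcc 0 t → ∀ c ∈ Set.uIcc 0 t,
      HasDerivAt (fun u => ∫ s in c..u, (f₁ s (x₁ s) - f₂ s (x₂ s)) a)
        ((f₁ u (x₁ u) - f₂ u (x₂ u)) a) u :=
    ae_all_iff.2 fun a => (intervalIntegrable_ofLp_apply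
      ((h₁.2 t ht).1.sub (h₂.2 t ht).1) a).ae_hasDerivAt_integral
  filter_upwards [h] with u hu hmem a
  have h3 := (hu a (by rw [Set.uIcc_of_le ht]; exact Set.Ioo_subset_Icc_self hmem) 0
    Set.left_mem_uIcc).const_add ((x₁ 0 - x₂ 0) a)
  refine h3.congr_of_eventuallyEq ?_
  -- The integral equation is known only for nonnegative times, so a two-sided derivative needs `u`
  -- to be positive.
  filter_upwards [Ioi_mem_nhds hmem.1] with v hv
  exact h₁.apply_sub_eq h₂ (le_of_lt hv) a

end Solutions

section Weights

variable {d : ℕ} {Y : ℝ → Matrix (Fin d) (Fin d) ℝ} {L : ℝ}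

theorem absolutelyContinuousOnInterval_entry
    (hY : ∀ s t : ℝ, 0 ≤ s → 0 ≤ t → opNorm (Y t - Y s) ≤ L * |t - s|) {s t : ℝ} (hs : 0 ≤ s)
    (hst : s ≤ t) (a b : Fin d) : AbsolutelyContinuousOnInterval (fun u => Y u a b) s t := by
  refine LipschitzOnWith.absolutelyContinuousOnInterval (K := L.toNNReal)
    (LipschitzOnWith.of_dist_le_mul fun x hx y hy => ?_)
  rw [Set.uIcc_of_le hst] at hx hy
  rw [Real.dist_eq, Real.dist_eq]
  refine (abs_entry_le_opNorm (Y x - Y y) a b).trans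
    ((hY y x (hs.trans hy.1) (hs.trans hx.1)).trans ?_)
  exact mul_le_mul_of_nonneg_right (Real.le_coe_toNNReal L) (abs_nonneg _)

/-- The derivative of a Lipschitz family of matrices is bounded as a quadratic form. -/
theorem quad_deriv_le (hL : 0 ≤ L)
    (hY : ∀ s t : ℝ, 0 ≤ s → 0 ≤ t → opNorm (Y t - Y s) ≤ L * |t - s|) {u : ℝ} (hu : 0 < u)
    {Y' : Matrix (Fin d) (Fin d) ℝ} (hd : ∀ a b, HasDerivAt (fun x => Y x a b) (Y' a b) u)
    (x : E d) : quad Y' x.ofLp ≤ L * ‖x‖ ^ 2 := by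
  have h1 : HasDerivAt (fun v => quad (Y v) x.ofLp) (quad Y' x.ofLp) u := by
    simp only [quad, dotProduct, Matrix.mulVec]
    exact HasDerivAt.fun_sum fun a _ => (HasDerivAt.fun_sum fun b _ =>
      (hd a b).mul_const _).const_mul _
  -- For a frozen `x` the scalar function `v ↦ x' Y(v) x` has Lipschitz constant `L ‖x‖²` around
  -- `u`, which bounds its derivative.
  refine (le_abs_self _).trans (h1.le_of_lip' (mul_nonneg hL (sq_nonneg _)) ?_)
  filter_upwards [Ioi_mem_nhds hu] with v hv
  have h2 : quad (Y v) x.ofLp - quad (Y u) x.ofLp = quad (Y v - Y u) x.ofLp := by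
    simp [quad, Matrix.sub_mulVec]
  rw [h2, Real.norm_eq_abs, Real.norm_eq_abs]
  refine (abs_quad_le_opNorm _ x).trans ?_
  calc _ ≤ L * |v - u| * ‖x‖ ^ 2 :=
        mul_le_mul_of_nonneg_right (hY u v hu.le (le_of_lt hv)) (sq_nonneg _)
    _ = _ := by ring

end Weights

end GainSync

/-! ### The storage function and the performance of the protocol. -/

namespace GainSync

theorem exists_pos_forall_le {σ : Type} [Finite σ] {f : σ → ℝ} (hf : ∀ k, 0 < f k) :
    ∃ c > 0, ∀ k, c ≤ f k := by
  rcases isEmpty_or_nonempty σ with h | h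
  · exact ⟨1, one_pos, fun k => h.elim k⟩
  · obtain ⟨k, hk⟩ := Finite.exists_min f
    exact ⟨f k, hf k, hk⟩

theorem exists_pos_mul_dotProduct_le_quad {d : ℕ} {P : Matrix (Fin d) (Fin d) ℝ} (hP : P.PosDef) :
    ∃ c > 0, ∀ x : Fin d → ℝ, c * (x ⬝ᵥ x) ≤ quad P x := by
  obtain ⟨c, hc, h⟩ := exists_pos_forall_le hP.eigenvalues_pos
  refine ⟨c, hc, fun x => ?_⟩
  -- In dimension zero the spectrum is empty and `lambdaMin` takes the default value `0`, so it is
  -- not bounded below by `c > 0`.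
  rcases Nat.eq_zero_or_pos d with rfl | hd
  · simp [quad, dotProduct]
  have : Nonempty (Fin d) := ⟨⟨0, hd⟩⟩
  refine le_trans (mul_le_mul_of_nonneg_right ?_ (dotProduct_self_nonneg' x))
    (lambdaMin_mul_le_quad hP.isHermitian x)
  rw [lambdaMin, hP.isHermitian.spectrum_real_eq_range_eigenvalues]
  exact le_csInf (Set.range_nonempty _) (by rintro _ ⟨k, rfl⟩; exact h k)

theorem InL2.integrableOn {d : ℕ} {w : ℝ → E d} (h : InL2 w) :
    IntegrableOn (fun t => ‖w t‖ ^ 2) (Set.Ici 0) := by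
  simpa [IntegrableOn] using MemLp.integrable_norm_pow h two_ne_zero

theorem sqL2_nonneg {d : ℕ} (w : ℝ → E d) : 0 ≤ sqL2 w := integral_nonneg fun _ => sq_nonneg _

namespace Network

variable {N n l r₀ : ℕ} {S : Network N n l r₀}

/-- The supply rate of the disturbances. -/
noncomputable def Disturbance.supply (d : S.Disturbance) (t : ℝ) : ℝ :=
  N * ‖d.w₀ t‖ ^ 2 + ∑ i, (‖d.w i t‖ ^ 2 + ∑ j, ‖d.wc i j t‖ ^ 2)

theorem Disturbance.supply_nonneg (d : S.Disturbance) (t : ℝ) : 0 ≤ d.supply t := by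
  unfold Disturbance.supply; positivity

theorem Disturbance.AllL2.integrableOn_supply {d : S.Disturbance} (h : d.AllL2) :
    IntegrableOn d.supply (Set.Ici 0) :=
  (h.1.integrableOn.const_mul _).add (integrable_finsetSum _ fun i _ =>
    (h.2.1 i).integrableOn.add (integrable_finsetSum _ fun j _ => (h.2.2 i j).integrableOn))

theorem Disturbance.AllL2.integral_supply {d : S.Disturbance} (h : d.AllL2) :
    ∫ t in Set.Ici 0, d.supply t =
      N * sqL2 d.w₀ + ∑ i, (sqL2 (d.w i) + ∑ j, sqL2 (d.wc i j)) := by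
  have hc : ∀ i, IntegrableOn (fun t => ∑ j, ‖d.wc i j t‖ ^ 2) (Set.Ici 0) := fun i =>
    integrable_finsetSum _ fun j _ => (h.2.2 i j).integrableOn
  have hw : ∀ i, IntegrableOn (fun t => ‖d.w i t‖ ^ 2 + ∑ j, ‖d.wc i j t‖ ^ 2) (Set.Ici 0) :=
    fun i => (h.2.1 i).integrableOn.add (hc i)
  have hs : IntegrableOn (fun t => ∑ i, (‖d.w i t‖ ^ 2 + ∑ j, ‖d.wc i j t‖ ^ 2)) (Set.Ici 0) :=
    integrable_finsetSum _ fun i _ => hw i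
  unfold Disturbance.supply
  rw [integral_add (h.1.integrableOn.const_mul _) hs, integral_const_mul,
    integral_finsetSum _ fun i _ => hw i]
  congr 1
  refine Finset.sum_congr rfl fun i _ => ?_
  rw [integral_add (h.2.1 i).integrableOn (hc i),
    integral_finsetSum _ fun j _ => (h.2.2 i j).integrableOn]
  rfl

theorem Disturbance.AllL2.intervalIntegrable_supply {d : S.Disturbance} (h : d.AllL2) {s t : ℝ}
    (hs : 0 ≤ s) (ht : 0 ≤ t) : IntervalIntegrable d.supply volume s t := by
  refine (h.integrableOn_supply.mono_set ?_).intervalIntegrable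
  exact fun u hu => (le_min hs ht).trans hu.1

theorem allL2_noDisturbance (S : Network N n l r₀) : S.noDisturbance.AllL2 :=
  ⟨MemLp.zero, fun _ => MemLp.zero, fun _ _ => MemLp.zero⟩

theorem supply_noDisturbance (S : Network N n l r₀) (t : ℝ) : S.noDisturbance.supply t = 0 := by
  simp [Disturbance.supply, noDisturbance]

theorem ofLp_error_eq_errorField {γ : ℝ} {Y : Fin N → ℝ → Matrix (Fin n) (Fin n) ℝ} {ρ : ℝ → ℝ}
    (d : S.Disturbance) (x : ℝ → E n) (xs : Fin N → ℝ → E n) (i : Fin N) (t : ℝ) :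
    ((mulE (S.A (ρ t)) (x t) + mulE S.B₁ (S.φ (x t)) + mulE S.B₂₀ (d.w₀ t)) -
      (mulE (S.A (ρ t)) (xs i t) + mulE S.B₁ (S.φ (xs i t)) +
        S.u ρ (S.obsGain γ Y) (S.conGain γ Y) d x xs i t + mulE (S.B₂ i) (d.w i t))).ofLp =
      errorField (S := S) γ Y (ρ t) i (fun j => (x t - xs j t).ofLp)
        (S.φ (x t) - S.φ (xs i t)).ofLp (d.w₀ t).ofLp (d.w i t).ofLp
        fun j => (d.wc i j t).ofLp := by
  have h1 : ∀ j, S.H i j *ᵥ ((x t - xs i t).ofLp - (x t - xs j t).ofLp) +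
      S.G i j *ᵥ (d.wc i j t).ofLp = S.H i j *ᵥ (xs j t).ofLp + S.G i j *ᵥ (d.wc i j t).ofLp -
        S.H i j *ᵥ (xs i t).ofLp := by
    intro j
    simp only [WithLp.ofLp_sub, Matrix.mulVec_sub]
    abel
  have h2 : S.C₂ i *ᵥ (x t - xs i t).ofLp + S.D₂ i *ᵥ (d.w i t).ofLp =
      S.C₂ i *ᵥ (x t).ofLp + S.D₂ i *ᵥ (d.w i t).ofLp - S.C₂ i *ᵥ (xs i t).ofLp := by
    simp only [WithLp.ofLp_sub, Matrix.mulVec_sub]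
    abel
  simp only [errorField, h1, h2]
  simp only [mulE, u, y, v, WithLp.ofLp_sub, WithLp.ofLp_add, WithLp.ofLp_sum,
    Matrix.mulVec_sub S.B₁, Matrix.mulVec_sub (S.A (ρ t))]
  abel

/-- The total storage of the errors. -/
noncomputable def storage (Y : Fin N → ℝ → Matrix (Fin n) (Fin n) ℝ) (ρ : ℝ → ℝ) (x : ℝ → E n)
    (xs : Fin N → ℝ → E n) (t : ℝ) : ℝ := ∑ i, quad (Y i (ρ t)) (x t - xs i t).ofLp

/-- The sum of the squared relative errors over all edges. -/
noncomputable def edgeSum (S : Network N n l r₀) (x : ℝ → E n) (xs : Fin N → ℝ → E n) (t : ℝ) : ℝ :=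
  ∑ i, ∑ j ∈ S.nbr i, ‖(x t - xs j t) - (x t - xs i t)‖ ^ 2

theorem edgeSum_nonneg (x : ℝ → E n) (xs : Fin N → ℝ → E n) (t : ℝ) : 0 ≤ S.edgeSum x xs t := by
  unfold edgeSum; positivity

/-- The properties of the schedule `Y` along the parameter signal `ρ` from which the performance of
the protocol follows. -/
structure Certificate (S : Network N n l r₀) (γ : ℝ) (δ : Fin N → ℝ)
    (Q : Fin N → Matrix (Fin n) (Fin n) ℝ) (R : Matrix (Fin n) (Fin n) ℝ)
    (Y : Fin N → ℝ → Matrix (Fin n) (Fin n) ℝ) (ρ : ℝ → ℝ) : Prop where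
  lipschitz : ∀ x₁ x₂ : E n, ‖S.φ x₁ - S.φ x₂‖ ^ 2 ≤ quad R (x₁ - x₂).ofLp
  E_pos : ∀ i, (S.E₂ i).PosDef
  F_pos : ∀ i, ∀ j ∈ S.nbr i, (S.F i j).PosDef
  δ_pos : ∀ i, 0 < δ i
  Q_pos : ∀ i, (Q i).PosDef
  Y_pos : ∀ t, 0 ≤ t → ∀ i, (Y i (ρ t)).PosDef
  dissipative : ∀ t, 0 ≤ t → ∀ i, S.Dissipative γ δ Q R (fun j => Y j (ρ t)) (ρ t) i
  variation : ∀ i, ∀ s t : ℝ, 0 ≤ s → 0 ≤ t →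
    opNorm (Y i (ρ t) - Y i (ρ s)) ≤ lambdaMin (Q i) * |t - s|
  coercive : ∃ c > 0, ∀ t, 0 ≤ t → ∀ i, ∀ z : Fin n → ℝ, c * (z ⬝ᵥ z) ≤ quad (Y i (ρ t)) z

namespace Certificate

variable {γ : ℝ} {δ : Fin N → ℝ} {Q : Fin N → Matrix (Fin n) (Fin n) ℝ}
  {R : Matrix (Fin n) (Fin n) ℝ} {Y : Fin N → ℝ → Matrix (Fin n) (Fin n) ℝ} {ρ : ℝ → ℝ}
  {d : S.Disturbance} {x : ℝ → E n} {xs : Fin N → ℝ → E n}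

theorem storage_nonneg (h : S.Certificate γ δ Q R Y ρ) {t : ℝ} (ht : 0 ≤ t) :
    0 ≤ storage Y ρ x xs t :=
  Finset.sum_nonneg fun i _ => quad_nonneg (h.Y_pos t ht i).posSemidef _

/-- The motion of the errors contributes the summed estimate over the network. The motion of the
weights contributes at most `λ_min(Q_i) ‖e_i‖² ≤ e_i' Q_i e_i`, which that estimate holds in
reserve. -/
theorem deriv_storage_le (h : S.Certificate γ δ Q R Y ρ)
    (htraj : S.IsTrajectory ρ (S.obsGain γ Y) (S.conGain γ Y) d x xs) {κ : ℝ}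
    (hκ : ∀ i, κ ≤ 2 * δ i / ((S.q i : ℝ) + 1)) {s t : ℝ} (hs : 0 ≤ s) (hst : s ≤ t) :
    ∀ᵐ u, u ∈ Set.Icc s t → deriv (storage Y ρ x xs) u + κ * storage Y ρ x xs u +
      S.edgeSum x xs u ≤ γ ^ 2 * d.supply u := by
  -- Without the endpoints, `u` is interior to `(0,t)`, where two-sided derivatives of the errors
  -- are available.
  have h0 : ∀ᵐ u : ℝ, u ≠ s := by simp [ae_iff, measure_singleton]
  have h1 : ∀ᵐ u : ℝ, u ≠ t := by simp [ae_iff, measure_singleton]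
  have he := ae_all_iff.2 fun i => htraj.1.ae_hasDerivAt_sub (htraj.2 i) t
  have hY := ae_all_iff.2 fun i => ae_all_iff.2 fun a => ae_all_iff.2 fun b =>
    (absolutelyContinuousOnInterval_entry (h.variation i) hs hst a b).ae_differentiableAt
  filter_upwards [h0, h1, he, hY] with u hus hut heu hYu hu
  have hu0 : 0 < u := hs.trans_lt (lt_of_le_of_ne hu.1 hus.symm)
  have hut' : u < t := lt_of_le_of_ne hu.2 hut
  set Y' : Fin N → Matrix (Fin n) (Fin n) ℝ := fun i =>
    Matrix.of fun a b => deriv (fun v => Y i (ρ v) a b) u with hY'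
  have hYd : ∀ i a b, HasDerivAt (fun v => Y i (ρ v) a b) (Y' i a b) u := fun i a b =>
    (hYu i a b (by rwa [Set.uIcc_of_le hst])).hasDerivAt
  have hed : ∀ i a, HasDerivAt (fun v => (x v - xs i v).ofLp a)
      (errorField (S := S) γ Y (ρ u) i (fun j => (x u - xs j u).ofLp)
        (S.φ (x u) - S.φ (xs i u)).ofLp (d.w₀ u).ofLp (d.w i u).ofLp
        (fun j => (d.wc i j u).ofLp) a) u := by
    intro i a
    rw [← ofLp_error_eq_errorField]
    exact heu i ⟨hu0, hut'⟩ a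
  have hV : HasDerivAt (storage Y ρ x xs) _ u := HasDerivAt.fun_sum fun i _ =>
    hasDerivAt_quad (Y := fun v => Y i (ρ v)) (e := fun v => (x v - xs i v).ofLp) (hYd i) (hed i)
      (by simpa using (h.Y_pos u hu0.le i).isHermitian.eq)
  have hsum := sum_two_mul_dotProduct_errorField_le h.E_pos h.F_pos (h.Y_pos u hu0.le)
    (h.dissipative u hu0.le) (fun j => (x u - xs j u).ofLp)
    (fun i => (S.φ (x u) - S.φ (xs i u)).ofLp) (d.w₀ u).ofLp (fun i => (d.w i u).ofLp)
    (fun i j => (d.wc i j u).ofLp)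
    (fun i => by rw [← norm_sq_eq_dotProduct]; exact h.lipschitz _ _)
  simp only [← WithLp.ofLp_sub, ← norm_sq_eq_dotProduct] at hsum
  have hQ : ∀ i, quad (Y' i) (x u - xs i u).ofLp ≤ quad (Q i) (x u - xs i u).ofLp := by
    intro i
    refine (quad_deriv_le (Y := fun v => Y i (ρ v)) (lambdaMin_nonneg (h.Q_pos i)) (h.variation i)
      hu0 (hYd i) _).trans ?_
    rw [norm_sq_eq_dotProduct]
    exact lambdaMin_mul_le_quad (h.Q_pos i).isHermitian _
  have hκV : κ * storage Y ρ x xs u ≤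
      ∑ i, 2 * δ i / ((S.q i : ℝ) + 1) * quad (Y i (ρ u)) (x u - xs i u).ofLp := by
    rw [storage, Finset.mul_sum]
    exact Finset.sum_le_sum fun i _ => mul_le_mul_of_nonneg_right (hκ i)
      (quad_nonneg (h.Y_pos u hu0.le i).posSemidef _)
  have hQs := Finset.sum_le_sum fun i (_ : i ∈ Finset.univ) => hQ i
  rw [hV.deriv]
  simp only [Finset.sum_add_distrib] at hsum ⊢
  simp only [edgeSum, Disturbance.supply, Finset.sum_add_distrib] at hsum ⊢
  linarith

theorem continuousOn_edgeSum
    {L : S.ObsGain} {K : S.ConGain} (htraj : S.IsTrajectory ρ L K d x xs) :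
    ContinuousOn (S.edgeSum x xs) (Set.Ici 0) := by
  have h0 := htraj.1.1
  have h1 : ∀ i, ContinuousOn (xs i) (Set.Ici 0) := fun i => (htraj.2 i).1
  unfold edgeSum
  refine continuousOn_finsetSum _ fun i _ => continuousOn_finsetSum _ fun j _ => ?_
  exact (((h0.sub (h1 j)).sub (h0.sub (h1 i))).norm.pow 2)

theorem intervalIntegrable_edgeSum {L : S.ObsGain} {K : S.ConGain}
    (htraj : S.IsTrajectory ρ L K d x xs) {s t : ℝ} (hs : 0 ≤ s) (ht : 0 ≤ t) :
    IntervalIntegrable (S.edgeSum x xs) volume s t :=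
  ((continuousOn_edgeSum htraj).mono fun _ hu => (le_min hs ht).trans hu.1).intervalIntegrable

/-- The energy balance with an exponential weight. -/
theorem exp_mul_storage_le (h : S.Certificate γ δ Q R Y ρ)
    (htraj : S.IsTrajectory ρ (S.obsGain γ Y) (S.conGain γ Y) d x xs) (hd : d.AllL2) {κ : ℝ}
    (hκ : ∀ i, κ ≤ 2 * δ i / ((S.q i : ℝ) + 1)) {s t : ℝ} (hs : 0 ≤ s) (hst : s ≤ t) :
    Real.exp (κ * t) * storage Y ρ x xs t + ∫ u in s..t, Real.exp (κ * u) * S.edgeSum x xs u ≤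
      Real.exp (κ * s) * storage Y ρ x xs s +
        ∫ u in s..t, Real.exp (κ * u) * (γ ^ 2 * d.supply u) := by
  refine exp_mul_add_integral_le hst ?_ (intervalIntegrable_edgeSum htraj hs (hs.trans hst))
    ((hd.intervalIntegrable_supply hs (hs.trans hst)).const_mul _)
    (h.deriv_storage_le htraj hκ hs hst)
  exact absolutelyContinuousOnInterval_sum _ fun i _ => absolutelyContinuousOnInterval_quad
    (fun a b => absolutelyContinuousOnInterval_entry (h.variation i) hs hst a b)
    fun a => htraj.1.absolutelyContinuousOnInterval_sub (htraj.2 i) hs hst a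

theorem exists_decay_rate (h : S.Certificate γ δ Q R Y ρ) :
    ∃ κ > 0, ∀ i, κ ≤ 2 * δ i / ((S.q i : ℝ) + 1) :=
  exists_pos_forall_le fun i => div_pos (mul_pos two_pos (h.δ_pos i)) (by positivity)

/-- The edge terms are dropped and the weight under the supply integral is replaced by its final
value. This forgets the decay of past supply, which is harmless when the supply after `s` is small.
-/
theorem storage_le (h : S.Certificate γ δ Q R Y ρ)
    (htraj : S.IsTrajectory ρ (S.obsGain γ Y) (S.conGain γ Y) d x xs) (hd : d.AllL2) {κ : ℝ}
    (hκ0 : 0 < κ) (hκ : ∀ i, κ ≤ 2 * δ i / ((S.q i : ℝ) + 1)) {s t : ℝ} (hs : 0 ≤ s)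
    (hst : s ≤ t) : storage Y ρ x xs t ≤
      Real.exp (-κ * (t - s)) * storage Y ρ x xs s + γ ^ 2 * ∫ u in s..t, d.supply u := by
  have h1 := h.exp_mul_storage_le htraj hd hκ hs hst
  have h2 : 0 ≤ ∫ u in s..t, Real.exp (κ * u) * S.edgeSum x xs u :=
    intervalIntegral.integral_nonneg hst fun u _ =>
      mul_nonneg (Real.exp_pos _).le (edgeSum_nonneg _ _ _)
  have hi := hd.intervalIntegrable_supply hs (hs.trans hst)
  have h3 : ∫ u in s..t, Real.exp (κ * u) * (γ ^ 2 * d.supply u) ≤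
      Real.exp (κ * t) * (γ ^ 2 * ∫ u in s..t, d.supply u) := by
    rw [← intervalIntegral.integral_const_mul, ← intervalIntegral.integral_const_mul]
    refine intervalIntegral.integral_mono_on hst
      ((hi.const_mul _).continuousOn_mul (by fun_prop)) ((hi.const_mul _).const_mul _) ?_
    intro u hu
    refine mul_le_mul_of_nonneg_right (Real.exp_le_exp.2 ?_)
      (mul_nonneg (sq_nonneg _) (d.supply_nonneg u))
    exact mul_le_mul_of_nonneg_left hu.2 hκ0.le
  have h4 : Real.exp (κ * s) = Real.exp (κ * t) * Real.exp (-κ * (t - s)) := by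
    rw [← Real.exp_add]; congr 1; ring
  rw [h4] at h1
  refine le_of_mul_le_mul_left ?_ (Real.exp_pos (κ * t))
  linarith

theorem norm_sq_le_storage {c : ℝ}
    (hc : ∀ t, 0 ≤ t → ∀ i, ∀ z : Fin n → ℝ, c * (z ⬝ᵥ z) ≤ quad (Y i (ρ t)) z) {t : ℝ}
    (ht : 0 ≤ t) : c * ∑ i, ‖x t - xs i t‖ ^ 2 ≤ storage Y ρ x xs t := by
  rw [storage, Finset.mul_sum]
  refine Finset.sum_le_sum fun i _ => ?_
  rw [norm_sq_eq_dotProduct]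
  exact hc t ht i _

theorem exp_stable (h : S.Certificate γ δ Q R Y ρ) :
    ∃ c > 0, ∃ ω > 0, ∀ (x : ℝ → E n) (xs : Fin N → ℝ → E n),
      S.IsTrajectory ρ (S.obsGain γ Y) (S.conGain γ Y) S.noDisturbance x xs → ∀ i, ∀ t, 0 ≤ t →
        ‖x t - xs i t‖ ^ 2 ≤ c * Real.exp (-ω * t) * ∑ j, ‖x 0 - xs j 0‖ ^ 2 := by
  obtain ⟨κ, hκ0, hκ⟩ := h.exists_decay_rate
  obtain ⟨c, hc0, hc⟩ := h.coercive
  set C := ∑ i, opNorm (Y i (ρ 0)) with hC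
  have hC0 : 0 ≤ C := Finset.sum_nonneg fun i _ => opNorm_nonneg _
  -- `C` may vanish in state dimension zero; the summand `1` keeps the constant positive.
  refine ⟨c⁻¹ * (C + 1), by positivity, κ, hκ0, fun x xs htraj i t ht => ?_⟩
  have h1 := h.storage_le htraj S.allL2_noDisturbance hκ0 hκ le_rfl ht
  simp only [supply_noDisturbance, intervalIntegral.integral_zero, mul_zero, add_zero,
    sub_zero] at h1
  have h2 := norm_sq_le_storage (x := x) (xs := xs) hc ht
  have h3 : storage Y ρ x xs 0 ≤ C * ∑ j, ‖x 0 - xs j 0‖ ^ 2 := by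
    rw [storage, Finset.mul_sum]
    refine Finset.sum_le_sum fun j _ => ?_
    refine ((le_abs_self _).trans (abs_quad_le_opNorm _ _)).trans ?_
    exact mul_le_mul_of_nonneg_right (Finset.single_le_sum (f := fun i => opNorm (Y i (ρ 0)))
      (fun i _ => opNorm_nonneg _) (Finset.mem_univ j)) (sq_nonneg _)
  have h4 : ‖x t - xs i t‖ ^ 2 ≤ ∑ j, ‖x t - xs j t‖ ^ 2 :=
    Finset.single_le_sum (f := fun j => ‖x t - xs j t‖ ^ 2) (fun _ _ => sq_nonneg _)
      (Finset.mem_univ i)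
  have h5 : 0 ≤ ∑ j, ‖x 0 - xs j 0‖ ^ 2 := Finset.sum_nonneg fun _ _ => sq_nonneg _
  have h6 : c * ‖x t - xs i t‖ ^ 2 ≤
      Real.exp (-κ * t) * ((C + 1) * ∑ j, ‖x 0 - xs j 0‖ ^ 2) :=
    calc _ ≤ c * ∑ j, ‖x t - xs j t‖ ^ 2 := mul_le_mul_of_nonneg_left h4 hc0.le
      _ ≤ _ := h2.trans (h1.trans (mul_le_mul_of_nonneg_left (by linarith) (Real.exp_pos _).le))
  calc ‖x t - xs i t‖ ^ 2 = c⁻¹ * (c * ‖x t - xs i t‖ ^ 2) := by field_simp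
    _ ≤ c⁻¹ * (Real.exp (-κ * t) * ((C + 1) * ∑ j, ‖x 0 - xs j 0‖ ^ 2)) :=
      mul_le_mul_of_nonneg_left h6 (inv_nonneg.2 hc0.le)
    _ = _ := by ring

/-- The supply is integrable, so after a late time `s` little energy enters, while the storage
present at `s` decays exponentially. Each contribution is made smaller than `ε/2`. -/
theorem converge (h : S.Certificate γ δ Q R Y ρ)
    (htraj : S.IsTrajectory ρ (S.obsGain γ Y) (S.conGain γ Y) d x xs) (hd : d.AllL2) :
    Filter.Tendsto (fun t => ∑ i, ‖x t - xs i t‖ ^ 2) Filter.atTop (𝓝 0) := by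
  obtain ⟨κ, hκ0, hκ⟩ := h.exists_decay_rate
  obtain ⟨c, hc0, hc⟩ := h.coercive
  have hint : IntegrableOn d.supply (Set.Ioi 0) :=
    hd.integrableOn_supply.mono_set Set.Ioi_subset_Ici_self
  have hlim := intervalIntegral_tendsto_integral_Ioi 0 hint Filter.tendsto_id
  have hle : ∀ t, 0 ≤ t → ∫ u in (0 : ℝ)..t, d.supply u ≤ ∫ u in Set.Ioi 0, d.supply u := by
    intro t ht
    rw [intervalIntegral.integral_of_le ht]
    exact setIntegral_mono_set hint (Filter.Eventually.of_forall d.supply_nonneg)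
      Set.Ioc_subset_Ioi_self.eventuallyLE
  have hstor : Filter.Tendsto (storage Y ρ x xs) Filter.atTop (𝓝 0) := by
    rw [Metric.tendsto_atTop']
    intro ε hε
    have h1 : Filter.Tendsto (fun t : ℝ => γ ^ 2 * ((∫ u in Set.Ioi 0, d.supply u) -
        ∫ u in (0 : ℝ)..t, d.supply u)) Filter.atTop (𝓝 0) := by
      simpa using (hlim.const_sub (∫ u in Set.Ioi 0, d.supply u)).const_mul (γ ^ 2)
    obtain ⟨s, hs, hs0⟩ := ((h1.eventually (gt_mem_nhds (half_pos hε))).and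
      (Filter.eventually_ge_atTop 0)).exists
    have h2 : Filter.Tendsto (fun t => Real.exp (-κ * (t - s)) * storage Y ρ x xs s)
        Filter.atTop (𝓝 0) := by
      have : Filter.Tendsto (fun t : ℝ => -κ * (t - s)) Filter.atTop Filter.atBot :=
        (Filter.tendsto_atTop_add_const_right _ (-s) Filter.tendsto_id).const_mul_atTop_of_neg
          (neg_neg_of_pos hκ0)
      simpa using (Real.tendsto_exp_atBot.comp this).mul_const (storage Y ρ x xs s)
    obtain ⟨T, hT⟩ := Filter.eventually_atTop.1 (h2.eventually (gt_mem_nhds (half_pos hε)))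
    refine ⟨max s T, fun t ht => ?_⟩
    have hst : s ≤ t := (le_max_left _ _).trans ht.le
    have ht0 : 0 ≤ t := hs0.trans hst
    have h3 := h.storage_le htraj hd hκ0 hκ hs0 hst
    have h4 : ∫ u in s..t, d.supply u ≤ (∫ u in Set.Ioi 0, d.supply u) -
        ∫ u in (0 : ℝ)..s, d.supply u := by
      have := intervalIntegral.integral_add_adjacent_intervals
        (hd.intervalIntegrable_supply le_rfl hs0) (hd.intervalIntegrable_supply hs0 ht0)
      linarith [hle t ht0]
    have h5 := mul_le_mul_of_nonneg_left h4 (sq_nonneg γ)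
    have h6 := hT t ((le_max_right _ _).trans ht.le)
    rw [Real.dist_eq, sub_zero, abs_of_nonneg (h.storage_nonneg ht0)]
    linarith
  have hup : Filter.Tendsto (fun t => c⁻¹ * storage Y ρ x xs t) Filter.atTop (𝓝 0) := by
    simpa using hstor.const_mul c⁻¹
  refine squeeze_zero' (Filter.Eventually.of_forall fun t => Finset.sum_nonneg fun _ _ =>
    sq_nonneg _) ?_ hup
  filter_upwards [Filter.eventually_ge_atTop 0] with t ht
  rw [inv_mul_eq_div, le_div_iff₀' hc0]
  exact norm_sq_le_storage hc ht

theorem integral_edgeSum_le (h : S.Certificate γ δ Q R Y ρ)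
    (htraj : S.IsTrajectory ρ (S.obsGain γ Y) (S.conGain γ Y) d x xs) (hd : d.AllL2) :
    IntegrableOn (S.edgeSum x xs) (Set.Ici 0) ∧ ∫ t in Set.Ici 0, S.edgeSum x xs t ≤
      storage Y ρ x xs 0 + γ ^ 2 * ∫ t in Set.Ici 0, d.supply t := by
  have hb : ∀ t, 0 ≤ t → ∫ u in (0 : ℝ)..t, S.edgeSum x xs u ≤
      storage Y ρ x xs 0 + γ ^ 2 * ∫ t in Set.Ici 0, d.supply t := by
    intro t ht
    -- Without the exponential weight, the energy balance bounds the integral of the edge terms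
    -- itself.
    have h1 := h.exp_mul_storage_le htraj hd (κ := 0)
      (fun i => div_nonneg (mul_nonneg two_pos.le (h.δ_pos i).le) (by positivity)) le_rfl ht
    simp only [zero_mul, Real.exp_zero, one_mul, intervalIntegral.integral_const_mul] at h1
    have h2 := h.storage_nonneg (x := x) (xs := xs) ht
    have h3 : ∫ u in (0 : ℝ)..t, d.supply u ≤ ∫ u in Set.Ici 0, d.supply u := by
      rw [intervalIntegral.integral_of_le ht]
      exact setIntegral_mono_set hd.integrableOn_supply
        (Filter.Eventually.of_forall d.supply_nonneg)
        (Set.Ioc_subset_Ioi_self.trans Set.Ioi_subset_Ici_self).eventuallyLE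
    have h4 := mul_le_mul_of_nonneg_left h3 (sq_nonneg γ)
    linarith
  have hint : IntegrableOn (S.edgeSum x xs) (Set.Ioi 0) := by
    -- The upper limits `max t 0` are nonnegative for every `t`, since trajectories are controlled
    -- only on `[0,∞)`.
    refine integrableOn_Ioi_of_intervalIntegral_norm_bounded
      (storage Y ρ x xs 0 + γ ^ 2 * ∫ t in Set.Ici 0, d.supply t) 0 (l := Filter.atTop)
      (b := fun t : ℝ => max t 0) (fun t => ?_)
      (Filter.tendsto_atTop_mono (fun t => le_max_left t 0) Filter.tendsto_id)
      (Filter.Eventually.of_forall fun t => ?_)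
    · exact (intervalIntegrable_edgeSum htraj le_rfl (le_max_right t 0)).1
    · simp only [Real.norm_of_nonneg (edgeSum_nonneg _ _ _)]
      exact hb _ (le_max_right t 0)
  refine ⟨by rwa [integrableOn_Ici_iff_integrableOn_Ioi], ?_⟩
  rw [integral_Ici_eq_integral_Ioi]
  refine le_of_tendsto (intervalIntegral_tendsto_integral_Ioi 0 hint Filter.tendsto_id) ?_
  filter_upwards [Filter.eventually_ge_atTop 0] with t ht using hb t ht

theorem disagreement_le (h : S.Certificate γ δ Q R Y ρ)
    (htraj : S.IsTrajectory ρ (S.obsGain γ Y) (S.conGain γ Y) d x xs) (hd : d.AllL2) (hN : 0 < N)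
    {P : Matrix (Fin n × Fin N) (Fin n × Fin N) ℝ} (hP : P.PosDef)
    (hPV : storage Y ρ x xs 0 ≤
      γ ^ 2 * N * quad P (fun k => (x 0 - xs k.2 0) k.1))
    (hdata : S.dataSq P (x 0) (fun i => xs i 0) d ≠ 0) :
    IntegrableOn (fun t => S.disagreement fun i => x t - xs i t) (Set.Ici 0) ∧
      (∫ t in Set.Ici (0 : ℝ), S.disagreement fun i => x t - xs i t) /
        S.dataSq P (x 0) (fun i => xs i 0) d ≤ γ ^ 2 := by
  obtain ⟨h1, h2⟩ := h.integral_edgeSum_le htraj hd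
  refine ⟨h1.const_mul _, ?_⟩
  have hN' : (0 : ℝ) < N := Nat.cast_pos.2 hN
  have hpos : 0 < S.dataSq P (x 0) (fun i => xs i 0) d := by
    refine lt_of_le_of_ne ?_ hdata.symm
    have a1 := quad_nonneg hP.posSemidef fun k => (x 0 - xs k.2 0) k.1
    have a2 := sqL2_nonneg d.w₀
    have a3 : 0 ≤ ∑ i, (sqL2 (d.w i) + ∑ j, sqL2 (d.wc i j)) :=
      Finset.sum_nonneg fun i _ => add_nonneg (sqL2_nonneg _)
        (Finset.sum_nonneg fun j _ => sqL2_nonneg _)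
    exact add_nonneg (add_nonneg a1 a2) (mul_nonneg (by positivity) a3)
  rw [div_le_iff₀ hpos]
  have h3 : ∫ t in Set.Ici (0 : ℝ), S.disagreement (fun i => x t - xs i t) =
      1 / (N : ℝ) * ∫ t in Set.Ici 0, S.edgeSum x xs t := integral_const_mul _ _
  rw [h3, one_div, inv_mul_le_iff₀ hN']
  rw [hd.integral_supply] at h2
  have h4 : (N : ℝ) * (γ ^ 2 * S.dataSq P (x 0) (fun i => xs i 0) d) =
      γ ^ 2 * N * quad P (fun k => (x 0 - xs k.2 0) k.1) +
        γ ^ 2 * (N * sqL2 d.w₀ + ∑ i, (sqL2 (d.w i) + ∑ j, sqL2 (d.wc i j))) := by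
    simp only [dataSq]
    field_simp
    ring
  linarith

/-- Both weights of the theorem are `c` times the initial storage matrix. The energy bound only
needs `V(0) ≤ γ² N c V(0)`: the choice `c = 1/(γ² N)` makes this an equality, and `c = 1/N` needs
`γ² ≥ 1`. -/
theorem weakSync (h : S.Certificate γ δ Q R Y ρ) {Γ : Set ℝ} (hN : 0 < N)
    (hL : ∀ i, ContinuousOn (S.obsGain γ Y i) Γ) (hK : ∀ i j, ContinuousOn (S.conGain γ Y i j) Γ)
    {c : ℝ} (hc : 0 < c) (hcγ : 1 ≤ γ ^ 2 * N * c) : S.WeakSync Γ ρ γ (S.obsGain γ Y)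
      (S.conGain γ Y) (Matrix.blockDiagonal fun i => c • Y i (ρ 0)) := by
  have hP : (Matrix.blockDiagonal fun i => c • Y i (ρ 0)).PosDef := by
    have hpos := fun i => (h.Y_pos 0 le_rfl i).smul hc
    refine Matrix.PosDef.of_dotProduct_mulVec_pos ?_ fun z hz => ?_
    · rw [Matrix.IsHermitian, Matrix.blockDiagonal_conjTranspose]
      exact congrArg _ (funext fun i => (hpos i).isHermitian.eq)
    · change 0 < quad _ z
      rw [quad_blockDiagonal]
      obtain ⟨k, hk⟩ := Function.ne_iff.1 hz
      refine Finset.sum_pos' (fun i _ => quad_nonneg (hpos i).posSemidef _)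
        ⟨k.2, Finset.mem_univ _, ?_⟩
      exact (hpos k.2).dotProduct_mulVec_pos (x := fun a => z (a, k.2))
        (Function.ne_iff.2 ⟨k.1, hk⟩)
  refine ⟨hL, fun i j _ => hK i j, hP, h.exp_stable, fun d x xs hd htraj hdata => ?_,
    fun d x xs hd htraj => h.converge htraj hd⟩
  refine h.disagreement_le htraj hd hN hP ?_ hdata
  rw [quad_blockDiagonal]
  simp only [quad_smul, ← Finset.mul_sum]
  have h1 : ∑ i, quad (Y i (ρ 0)) (fun a => (x 0 - xs i 0) a) = storage Y ρ x xs 0 := rfl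
  rw [h1, ← mul_assoc]
  exact le_mul_of_one_le_left (h.storage_nonneg le_rfl) hcγ

end Certificate

end Network

/-! ### Assembly for the interpolated schedules. -/

theorem certificate_schedule {N n l r₀ M : ℕ} {S : Network N n l r₀} {a b : ℝ}
    {R : Matrix (Fin n) (Fin n) ℝ} (hS : S.Standing R (Set.Icc a b)) {ρ : ℝ → ℝ}
    (hρ : DifferentiableOn ℝ ρ (Set.Ici 0)) (hρΓ : ∀ t, 0 ≤ t → ρ t ∈ Set.Icc a b) {γ : ℝ}
    {δ : Fin N → ℝ} (hδ : ∀ i, 0 < δ i) {Q : Fin N → Matrix (Fin n) (Fin n) ℝ}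
    (hQ : ∀ i, (Q i).PosDef) {g : Grid M} (hga : g.node 0 ≤ a) (hgb : b ≤ g.node (Fin.last M))
    {α : Fin (M + 1) → ℝ} (hcov : Covering S.A (Set.Icc a b) g α)
    {τ θ : Fin (M + 1) → Fin N → ℝ} {X : Fin (M + 1) → Fin N → Matrix (Fin n) (Fin n) ℝ}
    (hX : ∀ k, S.Feasible γ δ Q (X k) (g.node k) (α k) R (τ k) (θ k))
    (hrate : (⨆ t ∈ Set.Ici (0 : ℝ), ‖derivWithin ρ (Set.Ici 0) t‖ₑ) ≤ rateBound g Q X) :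
    S.Certificate γ δ Q R (schedule g X) ρ where
  lipschitz := hS.lipschitz
  E_pos := hS.E_pos
  F_pos := hS.F_pos
  δ_pos := hδ
  Q_pos := hQ
  Y_pos t ht i := posDef_schedule hX hga hgb hcov (hρΓ t ht) i
  dissipative t ht i := dissipative_schedule hX hga hgb hcov (hρΓ t ht) i
  variation i s t hs ht := opNorm_schedule_comp_sub_le hρ
    (fun t ht => ⟨hga.trans (hρΓ t ht).1, (hρΓ t ht).2.trans hgb⟩) hQ hrate i hs ht
  coercive := by
    -- The finitely many node matrices share one lower bound, and convex combinations preserve it;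
    -- hence it is uniform in time.
    choose c hc0 hc using fun p : Fin (M + 1) × Fin N =>
      exists_pos_mul_dotProduct_le_quad (hX p.1 p.2).2.2.1
    obtain ⟨m, hm0, hm⟩ := exists_pos_forall_le hc0
    refine ⟨m, hm0, fun t ht i z => ?_⟩
    refine schedule_induction (P := fun Y => m * (z ⬝ᵥ z) ≤ quad (Y i) z) (hρΓ t ht) hga hgb hcov
      (fun k _ => ?_) fun Y₁ Y₂ h₁ h₂ c hc hc' => ?_
    · exact (mul_le_mul_of_nonneg_right (hm (k, i)) (dotProduct_self_nonneg' z)).trans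
        (hc (k, i) z)
    · rw [quad_matrix_add, quad_smul, quad_smul]
      have := mul_le_mul_of_nonneg_left h₁ hc
      have := mul_le_mul_of_nonneg_left h₂ (sub_nonneg.2 hc')
      linarith

end GainSync

theorem theorem2 {N n l r₀ M : ℕ} (S : GainSync.Network N n l r₀)
    -- the parameter interval, the Lipschitz weight and the standing assumptions
    (a b : ℝ) (R : Matrix (Fin n) (Fin n) ℝ) (hS : S.Standing R (Set.Icc a b))
    -- the parameter signal
    (ρ : ℝ → ℝ) (hρ : ContDiffOn ℝ 1 ρ (Set.Ici 0)) (hρΓ : ∀ t, 0 ≤ t → ρ t ∈ Set.Icc a b)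
    -- the design constants
    (γ : ℝ) (hγ : 0 < γ) (δ : Fin N → ℝ) (hδ : ∀ i, 0 < δ i)
    (Q : Fin N → Matrix (Fin n) (Fin n) ℝ) (hQ : ∀ i, (Q i).PosDef)
    -- the grid
    (g : GainSync.Grid M) (hga : g.node 0 ≤ a) (hgb : b ≤ g.node (Fin.last M))
    (α : Fin (M + 1) → ℝ) (hα : ∀ k, 0 < α k)
    (hcov : GainSync.Covering S.A (Set.Icc a b) g α)
    -- feasible solutions of the coupled linear matrix inequalities at the grid points
    (τ θ : Fin (M + 1) → Fin N → ℝ) (X : Fin (M + 1) → Fin N → Matrix (Fin n) (Fin n) ℝ)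
    (hX : ∀ k, S.Feasible γ δ Q (X k) (g.node k) (α k) R (τ k) (θ k))
    -- the bound on the rate of the parameter
    (hrate : (⨆ t ∈ Set.Ici (0 : ℝ), ‖derivWithin ρ (Set.Ici 0) t‖ₑ) ≤ GainSync.rateBound g Q X) :
    S.WeakSync (Set.Icc a b) ρ γ
        (S.obsGain γ (GainSync.schedule g X)) (S.conGain γ (GainSync.schedule g X))
        (Matrix.blockDiagonal fun i => (1 / (γ ^ 2 * (N : ℝ))) • GainSync.schedule g X i (ρ 0)) ∧
      (1 ≤ γ → S.WeakSync (Set.Icc a b) ρ γ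
        (S.obsGain γ (GainSync.schedule g X)) (S.conGain γ (GainSync.schedule g X))
        (Matrix.blockDiagonal fun i => (1 / (N : ℝ)) • GainSync.schedule g X i (ρ 0))) := by
  have hN : 0 < N := Fin.pos_iff_nonempty.2 hS.weakly_connected.nonempty
  have hN' : (0 : ℝ) < N := Nat.cast_pos.2 hN
  have hcert := GainSync.certificate_schedule hS (hρ.differentiableOn one_ne_zero) hρΓ hδ hQ hga hgb
    hcov hX hrate
  have hsub : Set.Icc a b ⊆ Set.Icc (g.node 0) (g.node (Fin.last M)) := Set.Icc_subset_Icc hga hgb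
  have hpos := fun i x (hx : x ∈ Set.Icc a b) =>
    GainSync.posDef_schedule hX hga hgb hcov hx i
  have hL := fun i => GainSync.continuousOn_obsGain_schedule (S := S) (γ := γ) hsub (hpos i)
  have hK := fun i => GainSync.continuousOn_conGain_schedule (S := S) (γ := γ) hsub (hpos i)
  refine ⟨hcert.weakSync hN hL hK (by positivity) ?_,
    fun hγ1 => hcert.weakSync hN hL hK (by positivity) ?_⟩
  · rw [mul_one_div_cancel (by positivity)]
  · rw [mul_assoc, mul_one_div_cancel hN'.ne', mul_one]
    exact one_le_pow₀ hγ1
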